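/- Throughout, an $m$-polytope is a full-dimensional convex polytope in $\mathbb{R}^m$. It is $k$-neighborly if every set of $k$ of its vertices is the vertex set of a face (the empty set and the polytope itself count as faces), and neighborly if it is $\lfloor m/2\rfloor$-neighborly. Two polytopes with vertices labeled by $1,\dots,n$ are combinatorially equivalent if the same sets of labels occur as vertex sets of faces. A smooth strictly convex body $K\subset\mathbb{R}^m$ is a compact convex set with nonempty interior whose boundary contains no nondegenerate segment and has a unique supporting hyperplane at each of its points. Let $a_1,\dots,a_n\in\mathbb{R}^m$ be labeled points. A lexicographic lifting of $(a_1,\dots,a_n)$ is a sequence of points $\widehat a_i=(a_i,h_i)\in\mathbb{R}^{m+1}$ with $h_i\in\mathbb{R}$ such that for each $i\ge m+2$: $h_i\neq 0$, and $\widehat a_i$ lies above (if $h_i>0$) or below (if $h_i<0$) every hyperplane spanned by points of $\{\widehat a_1,\dots,\widehat a_{i-1}\}$. Here a point $p$ is above (below) a hyperplane $\{x:\langle x,v\rangle=c\}$, presented by a normal vector $v$ whose last coordinate is positive, if $\langle p,v\rangle>c$ (respectively $<c$). The lifting is positive if $h_i\ge 0$ for all $i$. Theorem. Let $A=\{a_1,\dots,a_n\}\subset\mathbb{R}^d$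 be a configuration of $n\ge d+3$ labeled points in general position (no $d+1$ of them lie in a common hyperplane) that is the vertex set of a $k$-neighborly $d$-polytope $P$. Let $\widehat A\subset\mathbb{R}^{d+1}$ be a lexicographic lifting of $A$, let $\widehat{\widehat A}\subset\mathbb{R}^{d+2}$ be a positive lexicographic lifting of $\widehat A$ (with respect to the same labeling), and let $\widehat{\widehat P}=\operatorname{conv}(\widehat{\widehat A})$. Then: (i) $\widehat{\widehat P}$ is a $(k+1)$-neighborly $(d+2)$-polytope whose vertices are exactly the $n$ distinct points of $\widehat{\widehat A}$. In particular, if $P$ is neighborly, then so is $\widehat{\widehat P}$. (ii) For every smooth strictly convex body $K\subset\mathbb{R}^{d+2}$ there is a $(d+2)$-polytope, combinatorially equivalent to $\widehat{\widehat P}$ as a labeled polytope, all of whose vertices lie on the boundary of $K$. -/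

import Mathlib

namespace LexLifting

/-- The labelled points `A i` are pairwise distinct and are exactly the vertices of a
full-dimensional polytope in `ℝ^m` (an `m`-polytope), namely of their convex hull. -/
def IsPolytopeVertices {n m : ℕ} (A : Fin n → EuclideanSpace ℝ (Fin m)) : Prop :=
  Function.Injective A ∧
  (convexHull ℝ (Set.range A)).extremePoints ℝ = Set.range A ∧
  affineSpan ℝ (Set.range A) = ⊤

/-- No `m + 1` of the points lie on a common hyperplane of `ℝ^m`. -/
def InGeneralPosition {n m : ℕ} (A : Fin n → EuclideanSpace ℝ (Fin m)) : Prop :=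
  ∀ S : Finset (Fin n), S.card = m + 1 →
    ∀ v : EuclideanSpace ℝ (Fin m), v ≠ 0 → ∀ c : ℝ, ∃ i ∈ S, inner ℝ (A i) v ≠ c

/-- The face lattice of `conv A` as a family of sets of labels: each face `F` (the empty face and
the whole polytope included) is recorded as the set of labels of the points lying in `F`. -/
def faceLabels {n m : ℕ} (A : Fin n → EuclideanSpace ℝ (Fin m)) : Set (Set (Fin n)) :=
  {S | ∃ F : Set (EuclideanSpace ℝ (Fin m)),
    IsExposed ℝ (convexHull ℝ (Set.range A)) F ∧ S = A ⁻¹' F}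

/-- Every set of `k` vertices forms a face. -/
def IsKNeighborly {n m : ℕ} (k : ℕ) (A : Fin n → EuclideanSpace ℝ (Fin m)) : Prop :=
  ∀ S : Finset (Fin n), S.card = k → (S : Set (Fin n)) ∈ faceLabels A

/-- A configuration in `ℝ^m` is neighborly if it is `⌊m/2⌋`-neighborly. -/
def IsNeighborly {n m : ℕ} (A : Fin n → EuclideanSpace ℝ (Fin m)) : Prop :=
  IsKNeighborly (m / 2) A

/-- Combinatorial equivalence of vertex-labelled polytopes: the face lattices coincide. -/
def CombinatoriallyEquivalent {n m m' : ℕ} (A : Fin n → EuclideanSpace ℝ (Fin m))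
    (B : Fin n → EuclideanSpace ℝ (Fin m')) : Prop :=
  faceLabels A = faceLabels B

/-- The set `{x | ⟨x, v⟩ = c}`, a hyperplane if `v ≠ 0`. -/
def hyperplane {m : ℕ} (v : EuclideanSpace ℝ (Fin m)) (c : ℝ) : Set (EuclideanSpace ℝ (Fin m)) :=
  {x | inner ℝ x v = c}

/-- `H` is the affine span of some of the points of `T`. -/
def IsSpannedBy {m : ℕ} (H T : Set (EuclideanSpace ℝ (Fin m))) : Prop :=
  ∃ S ⊆ T, (affineSpan ℝ S : Set (EuclideanSpace ℝ (Fin m))) = H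

/-- `p` is above every (non-vertical) hyperplane spanned by points of `T`. -/
def IsAboveSpanned {m : ℕ} (p : EuclideanSpace ℝ (Fin (m + 1)))
    (T : Set (EuclideanSpace ℝ (Fin (m + 1)))) : Prop :=
  ∀ (v : EuclideanSpace ℝ (Fin (m + 1))) (c : ℝ), 0 < v (Fin.last m) →
    IsSpannedBy (hyperplane v c) T → c < inner ℝ p v

/-- `p` is below every (non-vertical) hyperplane spanned by points of `T`. -/
def IsBelowSpanned {m : ℕ} (p : EuclideanSpace ℝ (Fin (m + 1)))
    (T : Set (EuclideanSpace ℝ (Fin (m + 1)))) : Prop :=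
  ∀ (v : EuclideanSpace ℝ (Fin (m + 1))) (c : ℝ), 0 < v (Fin.last m) →
    IsSpannedBy (hyperplane v c) T → inner ℝ p v < c

/-- The height of the `i`-th point of a lifted configuration: its last coordinate. -/
def height {n m : ℕ} (B : Fin n → EuclideanSpace ℝ (Fin (m + 1))) (i : Fin n) : ℝ :=
  B i (Fin.last m)

/-- `B` is a lexicographic lifting of `A`: `B i = (A i, h i)`, and from the `(m+2)`-nd point on
(index `m + 1` in `Fin n`) the height is nonzero and the lifted point is above, respectively below,
every hyperplane spanned by earlier lifted points, according to the sign of its height. -/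
def IsLexLifting {n m : ℕ} (A : Fin n → EuclideanSpace ℝ (Fin m))
    (B : Fin n → EuclideanSpace ℝ (Fin (m + 1))) : Prop :=
  (∀ (i : Fin n) (j : Fin m), B i j.castSucc = A i j) ∧
  ∀ i : Fin n, m + 1 ≤ (i : ℕ) →
    height B i ≠ 0 ∧
    (0 < height B i → IsAboveSpanned (B i) (B '' {j | j < i})) ∧
    (height B i < 0 → IsBelowSpanned (B i) (B '' {j | j < i}))

/-- A positive lexicographic lifting: all heights are nonnegative. -/
def IsPositiveLexLifting {n m : ℕ} (A : Fin n → EuclideanSpace ℝ (Fin m))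
    (B : Fin n → EuclideanSpace ℝ (Fin (m + 1))) : Prop :=
  IsLexLifting A B ∧ ∀ i, 0 ≤ height B i

/-- `H` is a supporting hyperplane of `K` at the point `p`. -/
def IsSupportingHyperplane {m : ℕ} (K : Set (EuclideanSpace ℝ (Fin m)))
    (p : EuclideanSpace ℝ (Fin m)) (H : Set (EuclideanSpace ℝ (Fin m))) : Prop :=
  ∃ v : EuclideanSpace ℝ (Fin m), v ≠ 0 ∧ H = hyperplane v (inner ℝ p v) ∧
    ∀ x ∈ K, inner ℝ x v ≤ inner ℝ p v

/-- Smooth strictly convex bodies: full-dimensional compact convex sets whose boundary contains no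
segment and has a unique supporting hyperplane at each of its points. -/
structure IsSmoothStrictlyConvexBody {m : ℕ} (K : Set (EuclideanSpace ℝ (Fin m))) : Prop where
  isCompact : IsCompact K
  convex : Convex ℝ K
  interior_nonempty : (interior K).Nonempty
  no_segment : ∀ x y : EuclideanSpace ℝ (Fin m), x ≠ y → ¬ segment ℝ x y ⊆ frontier K
  smooth : ∀ p ∈ frontier K, ∃! H : Set (EuclideanSpace ℝ (Fin m)), IsSupportingHyperplane K p H

/-- The `m`-polytope with labelled vertices `A` is combinatorially equivalent to an `m`-polytope
with all its vertices on the boundary of `K`. -/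
def IsInscribable {n m : ℕ} (K : Set (EuclideanSpace ℝ (Fin m)))
    (A : Fin n → EuclideanSpace ℝ (Fin m)) : Prop :=
  ∃ Q : Fin n → EuclideanSpace ℝ (Fin m),
    IsPolytopeVertices Q ∧ (∀ i, Q i ∈ frontier K) ∧ CombinatoriallyEquivalent A Q

end LexLifting

/-!
Everything is read off from the affine dependences of a configuration, the vectors `x` with
`∑ i, x i = 0` and `∑ i, x i • A i = 0`. They form a subspace of `ℝ^n` which, in general position,
is uniform: its vectors of minimal support, the circuits, live on the sets of `m + 2` labels and are
unique up to scaling (`InGeneralPosition.isUniform`). By Gale duality (`mem_faceLabels_iff`) a set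
of labels is a face exactly if no dependence is nonnegative and nonzero outside it, and by conformal
elimination (`IsUniform.exists_conformal_circuit`) it suffices to look at circuits. So the signs of
the circuits determine the labelled face lattice.

Lifting by heights `g` replaces the dependences by those orthogonal to `g`. If the lifting is
lexicographic, the sign of `g` on a circuit is dictated by the last element of the circuit
(`IsLexLifting.isLexHeight`). Hence a circuit of the lifting is, up to signs, a circuit of the
original configuration with one later element added, whose sign is forced by the signs of the
heights (`IsLexHeight.exists_circuit_of_slice`, `IsLexHeight.last_two_signs`). For the second,
positive lifting the last two elements of each circuit have opposite signs, so a circuit of the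
double lifting arises from one of `A` by adding one positive and one negative element. This gives
one more degree of neighborliness (`isKNeighborly_of_double_slice`). Degree one, which always holds,
says that all points are vertices.

The circuit signs of the double lifting thus depend only on those of `A` and on the signs of the
first heights (`CircuitSignsLE.slice`). For part (ii) it remains to find, for prescribed signs, a
double lifting that is projectively equivalent to a configuration on the boundary of `K`. Take a
boundary point `p` with outer normal `v`, identify `v^⊥` with `ℝ^(d + 1)`, and write points as
`p + t • (b - v)`. The projective transformation with coordinates `(b, 1 / t)` sends `p` to the
vertical point at infinity. By smoothness at `p` every ray in a direction `b - v` enters the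
interior of `K`, so it leaves `K` at a boundary point with `t > 0`; by strict convexity `1 / t`
grows superlinearly in `b`. Choosing the last coordinate of the `b`'s one after the other, each
large compared with the previous ones, makes both liftings lexicographic (`exists_lexHeights`,
`exists_inscribed`). The transformation rescales dependences by positive factors, so it preserves
circuit signs.
-/

namespace LexLifting

/-! ### Uniform subspaces and their circuits -/

section Uniform

variable {n r : ℕ}

/-- The support of a vector, as a finset of coordinates. -/
noncomputable def supp (x : Fin n → ℝ) : Finset (Fin n) := {i | x i ≠ 0}

@[simp] lemma mem_supp {x : Fin n → ℝ} {i : Fin n} : i ∈ supp x ↔ x i ≠ 0 := by simp [supp]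

lemma eq_zero_of_notMem_supp {x : Fin n → ℝ} {i : Fin n} (h : i ∉ supp x) : x i = 0 := by
  simpa using h

/-- A subspace `L` of `ℝ^n` is uniform of rank `r` if its nonzero vectors have more than `r`
nonzero coordinates and every set of more than `r` coordinates supports one of them: the minimal
supports of `L` are exactly the sets of size `r + 1`. -/
structure IsUniform (L : Submodule ℝ (Fin n → ℝ)) (r : ℕ) : Prop where
  lt_card : ∀ x ∈ L, x ≠ 0 → r < (supp x).card
  exists_mem : ∀ T : Finset (Fin n), r < T.card → ∃ x ∈ L, x ≠ 0 ∧ supp x ⊆ T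

/-- A circuit of a uniform subspace of rank `r`: a vector of minimal support. -/
structure IsCircuit (L : Submodule ℝ (Fin n → ℝ)) (r : ℕ) (x : Fin n → ℝ) : Prop where
  mem : x ∈ L
  card_supp : (supp x).card = r + 1

/-- The index `i` is the last element of the finset `T`. -/
def IsLast (T : Finset (Fin n)) (i : Fin n) : Prop := i ∈ T ∧ ∀ j ∈ T, j ≤ i

lemma exists_isLast {T : Finset (Fin n)} (hT : T.Nonempty) : ∃ i, IsLast T i :=
  ⟨T.max' hT, T.max'_mem hT, fun j hj => T.le_max' j hj⟩

lemma IsLast.le_val {T : Finset (Fin n)} {i : Fin n} (h : IsLast T i) : T.card ≤ i + 1 := by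
  have : T ⊆ Finset.Iic i := fun j hj => Finset.mem_Iic.2 (h.2 j hj)
  simpa using Finset.card_le_card this

lemma IsCircuit.supp_nonempty {L : Submodule ℝ (Fin n → ℝ)} {x : Fin n → ℝ}
    (hx : IsCircuit L r x) : (supp x).Nonempty := by
  rw [← Finset.card_pos, hx.card_supp]; omega

lemma supp_smul {c : ℝ} (hc : c ≠ 0) (x : Fin n → ℝ) : supp (c • x) = supp x := by
  ext i; simp [hc]

lemma IsCircuit.smul {L : Submodule ℝ (Fin n → ℝ)} {x : Fin n → ℝ}
    (hx : IsCircuit L r x) {c : ℝ} (hc : c ≠ 0) : IsCircuit L r (c • x) :=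
  ⟨L.smul_mem c hx.mem, by rw [supp_smul hc, hx.card_supp]⟩

namespace IsUniform

variable {L : Submodule ℝ (Fin n → ℝ)}

lemma eq_zero (hL : IsUniform L r) {x : Fin n → ℝ} (hx : x ∈ L) (h : (supp x).card ≤ r) :
    x = 0 := by
  by_contra hne
  exact absurd (hL.lt_card x hx hne) (by omega)

lemma exists_circuit (hL : IsUniform L r) {T : Finset (Fin n)} (hT : T.card = r + 1) :
    ∃ x, IsCircuit L r x ∧ supp x = T := by
  obtain ⟨x, hx, hne, hsub⟩ := hL.exists_mem T (by omega)
  have h : supp x = T := Finset.eq_of_subset_of_card_le hsub (by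
    have := hL.lt_card x hx hne; omega)
  exact ⟨x, ⟨hx, by rw [h, hT]⟩, h⟩

lemma eq_smul (hL : IsUniform L r) {x y : Fin n → ℝ} (hx : IsCircuit L r x) (hy : y ∈ L)
    (h : supp y ⊆ supp x) {i : Fin n} (hi : x i ≠ 0) : y = (y i / x i) • x := by
  have hz : y - (y i / x i) • x = 0 := by
    apply hL.eq_zero (L.sub_mem hy (L.smul_mem _ hx.mem))
    have hsub : supp (y - (y i / x i) • x) ⊆ (supp x).erase i := by
      intro j hj
      rw [Finset.mem_erase]
      rw [mem_supp] at hj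
      constructor
      · rintro rfl
        apply hj
        simp [hi]
      · by_contra hjx
        have h1 := eq_zero_of_notMem_supp hjx
        have h2 := eq_zero_of_notMem_supp (fun h' => hjx (h h'))
        exact hj (by simp [h1, h2])
    have := Finset.card_le_card hsub
    rw [Finset.card_erase_of_mem (by simpa using hi), hx.card_supp] at this
    omega
  exact sub_eq_zero.1 hz

/-- Conformal elimination: every element `j` of the support of a vector `x` of a uniform subspace
lies in a circuit that has the signs of `x` on its whole support. -/
lemma exists_conformal_circuit (hL : IsUniform L r) {x : Fin n → ℝ} (hx : x ∈ L) {j : Fin n}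
    (hj : x j ≠ 0) :
    ∃ y, IsCircuit L r y ∧ y j ≠ 0 ∧ ∀ i, y i ≠ 0 → 0 < y i * x i := by
  classical
  -- Induction on the size of the support of `x`.
  induction hN : (supp x).card using Nat.strong_induction_on generalizing x with
  | _ N ih =>
  have hne : x ≠ 0 := fun h => hj (by simp [h])
  have hlt := hL.lt_card x hx hne
  rcases Nat.eq_or_lt_of_le (Nat.succ_le_of_lt hlt) with heq | hgt
  · exact ⟨x, ⟨hx, heq.symm⟩, hj, fun i hi => mul_self_pos.2 hi⟩
  obtain ⟨T, hTs, hT⟩ := Finset.exists_subset_card_eq (Nat.le_of_lt hgt)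
  -- It suffices to find a vector of smaller support that is conformal to `x`.
  have key : ∀ y ∈ L, y j ≠ 0 → (∀ i, y i ≠ 0 → 0 < y i * x i) → (∃ i, x i ≠ 0 ∧ y i = 0) →
      ∃ y, IsCircuit L r y ∧ y j ≠ 0 ∧ ∀ i, y i ≠ 0 → 0 < y i * x i := by
    rintro y hy hyj hc ⟨i, hxi, hyi⟩
    have hss : supp y ⊂ supp x := by
      refine (Finset.ssubset_iff_of_subset ?_).2 ⟨i, by simpa using hxi, by simpa using hyi⟩
      intro l hl
      rw [mem_supp] at hl ⊢
      have := hc l hl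
      intro h0; simp [h0] at this
    obtain ⟨z, hz, hzj, hzc⟩ := ih _ (hN ▸ Finset.card_lt_card hss) hy hyj rfl
    refine ⟨z, hz, hzj, fun i hi => ?_⟩
    have h1 := hzc i hi
    have h2 := hc i (by intro h0; simp [h0] at h1)
    have h3 : 0 < (z i * x i) * (y i) ^ 2 := by nlinarith [mul_pos h1 h2]
    exact pos_of_mul_pos_left h3 (by positivity)
  obtain ⟨y, hy, hyT⟩ := hL.exists_circuit hT
  -- Subtract from `x` the largest multiple of a circuit that keeps all signs.
  have reduce : ∀ z, IsCircuit L r z → supp z = T → z j * x j ≤ 0 → (∃ i, 0 < z i * x i) →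
      ∃ y, IsCircuit L r y ∧ y j ≠ 0 ∧ ∀ i, y i ≠ 0 → 0 < y i * x i := by
    intro z hz hzT hzj ⟨i₀, hi₀⟩
    obtain ⟨i, hi, hmin⟩ := Finset.exists_min_image
      ({i | 0 < z i * x i} : Finset (Fin n)) (fun i => x i / z i) ⟨i₀, by simpa using hi₀⟩
    simp only [Finset.mem_filter, Finset.mem_univ, true_and] at hi hmin
    have hzi : z i ≠ 0 := by intro h; simp [h] at hi
    have hxi : x i ≠ 0 := by intro h; simp [h] at hi
    have ht : 0 < x i / z i := by
      rw [← mul_div_mul_right _ _ hzi, ← sq, mul_comm]; positivity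
    have hval : ∀ l, (x - (x i / z i) • z) l * x l = x l ^ 2 - x i / z i * (z l * x l) := by
      intro l; simp; ring
    refine key (x - (x i / z i) • z) (L.sub_mem hx (L.smul_mem _ hz.mem)) ?_ ?_ ⟨i, hxi, ?_⟩
    · intro h0
      have := hval j
      rw [h0] at this
      have : 0 < x j ^ 2 := by positivity
      nlinarith [mul_nonneg ht.le (neg_nonneg.2 hzj)]
    · intro l hl
      have hxl : x l ≠ 0 := by
        intro h0
        have : l ∉ supp z := fun h => by
          have := hTs (hzT ▸ h); simp [h0] at this
        exact hl (by simp [h0, eq_zero_of_notMem_supp this])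
      have hge : 0 ≤ (x - (x i / z i) • z) l * x l := by
        rw [hval]
        rcases le_or_gt (z l * x l) 0 with h | h
        · nlinarith [mul_nonneg ht.le (neg_nonneg.2 h), sq_nonneg (x l)]
        · have hzl : z l ≠ 0 := by intro h'; simp [h'] at h
          have hm := mul_le_mul_of_nonneg_right (hmin l h) h.le
          have : x l / z l * (z l * x l) = x l ^ 2 := by field_simp
          linarith
      exact lt_of_le_of_ne hge (Ne.symm (mul_ne_zero hl hxl))
    · simp [hzi]
  have hneg : ∀ z : Fin n → ℝ, supp z = T → supp (-z) = T := by
    intro z hz; rw [← hz]; ext; simp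
  have hT0 : ∃ l, y l * x l ≠ 0 := by
    obtain ⟨l, hl⟩ := hy.supp_nonempty
    exact ⟨l, mul_ne_zero (by simpa using hl) (by simpa using hTs (hyT ▸ hl))⟩
  have hnot : ∃ i, x i ≠ 0 ∧ i ∉ T := by
    have : T ⊂ supp x := Finset.ssubset_iff_subset_ne.2 ⟨hTs, by
      rintro rfl; omega⟩
    obtain ⟨i, hi, hiT⟩ := (Finset.ssubset_iff_of_subset hTs).1 this
    exact ⟨i, by simpa using hi, hiT⟩
  -- Choose the sign of the circuit so that subtracting it does not decrease `|x j|`.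
  have main : ∀ z, IsCircuit L r z → supp z = T → z j * x j ≤ 0 →
      (z j = 0 → ∃ i, 0 < z i * x i) →
      ∃ y, IsCircuit L r y ∧ y j ≠ 0 ∧ ∀ i, y i ≠ 0 → 0 < y i * x i := by
    intro z hz hzT hzj h0
    by_cases hex : ∃ i, 0 < z i * x i
    · exact reduce z hz hzT hzj hex
    · have hzj0 : z j ≠ 0 := fun h => hex (h0 h)
      push Not at hex
      obtain ⟨i, hxi, hiT⟩ := hnot
      refine key (-z) (L.neg_mem hz.mem) (by simpa using hzj0) ?_
        ⟨i, hxi, by simpa using eq_zero_of_notMem_supp (hzT ▸ hiT)⟩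
      intro l hl
      have hzl : z l ≠ 0 := by simpa using hl
      have hxl : x l ≠ 0 := by
        have := hTs (hzT ▸ mem_supp.2 hzl); simpa using this
      have := lt_of_le_of_ne (hex l) (mul_ne_zero hzl hxl)
      simp; linarith
  have hyn : IsCircuit L r (-y) := by simpa using hy.smul (c := -1) (by norm_num)
  by_cases hyj : y j = 0
  · obtain ⟨l, hl⟩ := hT0
    rcases lt_or_gt_of_ne hl with h | h
    · exact main (-y) hyn (hneg y hyT) (by simp [hyj]) fun _ => ⟨l, by simpa using h⟩
    · exact main y hy hyT (by simp [hyj]) fun _ => ⟨l, h⟩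
  · rcases le_total (y j * x j) 0 with h | h
    · exact main y hy hyT h fun h0 => absurd h0 hyj
    · exact main (-y) hyn (hneg y hyT) (by simpa using h) fun h0 =>
        absurd (by simpa using h0) hyj

end IsUniform

/-! ### Lexicographic slices -/

/-- The vectors of `L` orthogonal to the height vector `g`. -/
def slice (L : Submodule ℝ (Fin n → ℝ)) (g : Fin n → ℝ) : Submodule ℝ (Fin n → ℝ) where
  carrier := {x | x ∈ L ∧ g ⬝ᵥ x = 0}
  add_mem' := fun ha hb => ⟨L.add_mem ha.1 hb.1, by rw [dotProduct_add, ha.2, hb.2, add_zero]⟩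
  zero_mem' := ⟨L.zero_mem, dotProduct_zero g⟩
  smul_mem' := fun c _ ha => ⟨L.smul_mem c ha.1, by rw [dotProduct_smul, ha.2, smul_zero]⟩

lemma mem_slice {L : Submodule ℝ (Fin n → ℝ)} {g x : Fin n → ℝ} :
    x ∈ slice L g ↔ x ∈ L ∧ g ⬝ᵥ x = 0 := Iff.rfl

/-- The heights `g` are lexicographic for `L`, with signs `σ`: on each circuit, the sign of the
height functional is the one dictated by its last element. -/
def IsLexHeight (L : Submodule ℝ (Fin n → ℝ)) (r : ℕ) (σ g : Fin n → ℝ) : Prop :=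
  ∀ x, IsCircuit L r x → ∀ i, IsLast (supp x) i → 0 < σ i * x i * (g ⬝ᵥ x)

namespace IsLexHeight

variable {L : Submodule ℝ (Fin n → ℝ)} {σ g : Fin n → ℝ}

lemma dotProduct_ne_zero (hg : IsLexHeight L r σ g) {x : Fin n → ℝ} (hx : IsCircuit L r x) :
    g ⬝ᵥ x ≠ 0 := by
  obtain ⟨i, hi⟩ := exists_isLast hx.supp_nonempty
  intro h
  simpa [h] using hg x hx i hi

lemma isUniform_slice (hg : IsLexHeight L r σ g) (hL : IsUniform L r) :
    IsUniform (slice L g) (r + 1) := by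
  classical
  constructor
  · intro x hx hne
    have h1 := hL.lt_card x hx.1 hne
    rcases Nat.lt_or_ge (r + 1) (supp x).card with h | h
    · exact h
    · exact absurd hx.2 (hg.dotProduct_ne_zero ⟨hx.1, by omega⟩)
  · intro T hT
    obtain ⟨T', hT's, hT'⟩ := Finset.exists_subset_card_eq (show r + 2 ≤ T.card by omega)
    obtain ⟨a, ha, b, hb, hab⟩ := Finset.one_lt_card.1 (show 1 < T'.card by omega)
    obtain ⟨x, hx, hxs⟩ := hL.exists_circuit (T := T'.erase a)
      (by rw [Finset.card_erase_of_mem ha, hT']; rfl)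
    obtain ⟨y, hy, hys⟩ := hL.exists_circuit (T := T'.erase b)
      (by rw [Finset.card_erase_of_mem hb, hT']; rfl)
    have hxa : x a = 0 := eq_zero_of_notMem_supp (by simp [hxs])
    have hya : y a ≠ 0 := by rw [← mem_supp, hys]; simp [ha, hab]
    refine ⟨(g ⬝ᵥ x) • y - (g ⬝ᵥ y) • x, ⟨L.sub_mem (L.smul_mem _ hy.mem) (L.smul_mem _ hx.mem), ?_⟩,
      ?_, ?_⟩
    · rw [dotProduct_sub, dotProduct_smul, dotProduct_smul, smul_eq_mul, smul_eq_mul]; ring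
    · intro h
      have := congrFun h a
      simp [hxa, hya, hg.dotProduct_ne_zero hx] at this
    · intro i hi
      apply hT's
      by_contra hiT
      have h1 : x i = 0 := eq_zero_of_notMem_supp (by simp [hxs, hiT])
      have h2 : y i = 0 := eq_zero_of_notMem_supp (by simp [hys, hiT])
      simp [h1, h2] at hi

/-- A circuit `x` of the slice restricts, away from its last element `i`, to a circuit `y` of `L`
up to positive rescaling of the coordinates, and the sign of `x i` is opposite to the one of the
height functional on `y`. -/
lemma exists_circuit_of_slice (hg : IsLexHeight L r σ g) (hL : IsUniform L r) {x : Fin n → ℝ}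
    (hx : IsCircuit (slice L g) (r + 1) x) {i : Fin n} (hi : IsLast (supp x) i) :
    ∃ y, IsCircuit L r y ∧ supp y = (supp x).erase i ∧ (∀ j, y j ≠ 0 → 0 < x j * y j) ∧
      σ i * x i * (g ⬝ᵥ y) < 0 := by
  classical
  have hcard : ∀ j ∈ supp x, ((supp x).erase j).card = r + 1 := fun j hj => by
    rw [Finset.card_erase_of_mem hj, hx.card_supp]; rfl
  obtain ⟨y, hy, hys⟩ := hL.exists_circuit (hcard i hi.1)
  have hxi : x i ≠ 0 := mem_supp.1 hi.1
  have hyi : y i = 0 := eq_zero_of_notMem_supp (by simp [hys])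
  -- Eliminating `i` between `x` and the circuit avoiding `j` leaves a multiple of `y`.
  have key : ∀ j, y j ≠ 0 → σ i * x i * (g ⬝ᵥ y) * (x j * y j) < 0 := by
    intro j hj
    have hj' : j ∈ (supp x).erase i := by rw [← hys]; simpa using hj
    have hji := Finset.ne_of_mem_erase hj'
    obtain ⟨z, hz, hzs⟩ := hL.exists_circuit (hcard j (Finset.mem_of_mem_erase hj'))
    have hzi : z i ≠ 0 := by
      rw [← mem_supp, hzs, Finset.mem_erase]; exact ⟨hji.symm, hi.1⟩
    have hzj : z j = 0 := eq_zero_of_notMem_supp (by simp [hzs])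
    have hlast : IsLast (supp z) i := ⟨mem_supp.2 hzi, fun l hl => by
      rw [hzs] at hl; exact hi.2 l (Finset.mem_of_mem_erase hl)⟩
    have hpos := hg z hz i hlast
    have hsub : supp (x - (x i / z i) • z) ⊆ supp y := by
      intro l hl
      rw [hys, Finset.mem_erase]
      rw [mem_supp] at hl
      constructor
      · rintro rfl; exact hl (by simp [hzi])
      · by_contra hlx
        have h1 := eq_zero_of_notMem_supp hlx
        have h2 : z l = 0 := eq_zero_of_notMem_supp (by simp [hzs, h1])
        exact hl (by simp [h1, h2])
    have heq := hL.eq_smul hy (L.sub_mem hx.mem.1 (L.smul_mem (x i / z i) hz.mem)) hsub hj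
    have hval : (x - (x i / z i) • z) j = x j := by simp [hzj]
    rw [hval] at heq
    have hdot := congrArg (fun w => g ⬝ᵥ w) heq
    simp only [dotProduct_sub, dotProduct_smul, hx.mem.2, smul_eq_mul] at hdot
    have hdot' : (g ⬝ᵥ y) * (x j * y j) = -(x i / z i) * (g ⬝ᵥ z) * y j ^ 2 := by
      have : x j / y j * (g ⬝ᵥ y) * y j ^ 2 = (g ⬝ᵥ y) * (x j * y j) := by field_simp
      rw [← this, ← hdot]; ring
    have : σ i * x i * (g ⬝ᵥ y) * (x j * y j)
        = -((x i / z i) ^ 2 * y j ^ 2 * (σ i * z i * (g ⬝ᵥ z))) := by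
      calc _ = σ i * x i * ((g ⬝ᵥ y) * (x j * y j)) := by ring
        _ = _ := by rw [hdot']; field_simp
    rw [this]
    have : 0 < (x i / z i) ^ 2 * y j ^ 2 := by positivity
    nlinarith [mul_pos this hpos]
  set a := σ i * x i * (g ⬝ᵥ y) with ha
  have ha0 : a ≠ 0 := by
    obtain ⟨j, hj⟩ := hy.supp_nonempty
    intro h0
    simpa [h0] using key j (by simpa using hj)
  -- Only the sign of `y` remains to be chosen.
  rcases lt_or_gt_of_ne ha0 with h | h
  · exact ⟨y, hy, hys, fun j hj => pos_of_mul_neg_right (key j hj) h.le, h⟩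
  · refine ⟨(-1 : ℝ) • y, hy.smul (by norm_num), by rw [supp_smul (by norm_num), hys],
      fun j hj => ?_, ?_⟩
    · have := key j (by simpa using hj)
      have : x j * y j < 0 := neg_of_mul_neg_right this h.le
      simp; linarith
    · rw [dotProduct_smul, smul_eq_mul]
      linarith

/-- The signs of the last two elements of a circuit of a lexicographic slice. -/
lemma last_two_signs (hg : IsLexHeight L r σ g) (hL : IsUniform L r) {x : Fin n → ℝ}
    (hx : IsCircuit (slice L g) (r + 1) x) {i j : Fin n} (hi : IsLast (supp x) i)
    (hj : IsLast ((supp x).erase i) j) : σ i * x i * (σ j * x j) < 0 := by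
  obtain ⟨y, hy, hys, hsign, hneg⟩ := hg.exists_circuit_of_slice hL hx hi
  have hpos := hg y hy j (hys ▸ hj)
  have hyj : y j ≠ 0 := by rw [← mem_supp, hys]; exact hj.1
  have h1 := mul_neg_of_neg_of_pos hneg hpos
  have h2 := hsign j hyj
  have hg0 := hg.dotProduct_ne_zero hy
  have h3 : σ i * x i * (g ⬝ᵥ y) * (σ j * y j * (g ⬝ᵥ y)) * (x j * y j)
      = σ i * x i * (σ j * x j) * ((g ⬝ᵥ y) ^ 2 * y j ^ 2) := by ring
  have h4 : σ i * x i * (σ j * x j) * ((g ⬝ᵥ y) ^ 2 * y j ^ 2) < 0 := by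
    rw [← h3]; exact mul_neg_of_neg_of_pos h1 h2
  exact neg_of_mul_neg_left h4 (by positivity)

end IsLexHeight

/-- Every sign vector of a circuit of `L` is one of a circuit of `L'`. -/
def CircuitSignsLE (L L' : Submodule ℝ (Fin n → ℝ)) (r : ℕ) : Prop :=
  ∀ x, IsCircuit L r x → ∃ y, IsCircuit L' r y ∧ ∀ i, SignType.sign (x i) = SignType.sign (y i)

lemma supp_eq_of_sign_eq {x y : Fin n → ℝ}
    (h : ∀ i, SignType.sign (x i) = SignType.sign (y i)) : supp x = supp y := by
  ext i
  rw [mem_supp, mem_supp, ← sign_ne_zero, h i, sign_ne_zero]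

lemma sign_eq_of_mul_pos {a b : ℝ} (h : 0 < a * b) : SignType.sign a = SignType.sign b := by
  rcases mul_pos_iff.1 h with ⟨h1, h2⟩ | ⟨h1, h2⟩
  · rw [sign_pos h1, sign_pos h2]
  · rw [sign_neg h1, sign_neg h2]

lemma mul_pos_of_sign_eq {a b : ℝ} (h : SignType.sign a = SignType.sign b) (ha : a ≠ 0) :
    0 < a * b := by
  rcases lt_or_gt_of_ne ha with h1 | h1
  · rw [sign_neg h1, eq_comm, sign_eq_neg_one_iff] at h; exact mul_pos_of_neg_of_neg h1 h
  · rw [sign_pos h1, eq_comm, sign_eq_one_iff] at h; exact mul_pos h1 h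

/-- The circuit signs of a lexicographic slice are determined by those of the subspace and by the
signs of the heights. -/
lemma CircuitSignsLE.slice {L L' : Submodule ℝ (Fin n → ℝ)} {σ g g' : Fin n → ℝ}
    (h : CircuitSignsLE L L' r) (hL : IsUniform L r) (hL' : IsUniform L' r)
    (hg : IsLexHeight L r σ g) (hg' : IsLexHeight L' r σ g') :
    CircuitSignsLE (slice L g) (slice L' g') (r + 1) := by
  intro x hx
  obtain ⟨i, hi⟩ := exists_isLast hx.supp_nonempty
  obtain ⟨y, hy, hys, hxy, -⟩ := hg.exists_circuit_of_slice hL hx hi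
  obtain ⟨z, hz, hyz⟩ := h y hy
  obtain ⟨w, hw, hws⟩ := (hg'.isUniform_slice hL').exists_circuit hx.card_supp
  obtain ⟨u, hu, hus, hwu, -⟩ := hg'.exists_circuit_of_slice hL' hw (hws ▸ hi)
  have hzs : supp z = (supp x).erase i := by rw [← supp_eq_of_sign_eq hyz, hys]
  have husz : supp u = supp z := by rw [hus, hws, hzs]
  obtain ⟨j, hj⟩ := exists_isLast (hzs ▸ hz.supp_nonempty)
  have hzj : z j ≠ 0 := by rw [← mem_supp, hzs]; exact hj.1
  have huj : u j ≠ 0 := by rw [← mem_supp, husz]; simpa using hzj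
  have hc := hL'.eq_smul hz hu.mem husz.subset hzj
  set c := u j / z j with hcdef
  have hc0 : c ≠ 0 := div_ne_zero huj hzj
  have hcw : ∀ l, z l ≠ 0 → 0 < x l * (c • w) l := by
    intro l hl
    have hyl : y l ≠ 0 := by rw [← mem_supp, supp_eq_of_sign_eq hyz]; simpa using hl
    have hul : u l ≠ 0 := by rw [← mem_supp, husz]; simpa using hl
    have h1 := hxy l hyl
    have h2 := mul_pos_of_sign_eq (hyz l) hyl
    have h3 := hwu l hul
    have h4 : u l = c * z l := congrFun hc l
    have h5 : 0 < x l * (c * w l) * (y l ^ 2 * z l ^ 2) := by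
      have : x l * (c * w l) * (y l ^ 2 * z l ^ 2) = (x l * y l) * (y l * z l) * (w l * u l) := by
        rw [h4]; ring
      rw [this]; positivity
    exact pos_of_mul_pos_left h5 (by positivity)
  refine ⟨c • w, hw.smul hc0, fun l => ?_⟩
  by_cases hlx : l ∈ supp x
  · apply sign_eq_of_mul_pos
    rcases eq_or_ne l i with rfl | hli
    · have h1 := hg.last_two_signs hL hx hi hj
      have h2 := hg'.last_two_signs hL' hw (hws ▸ hi) (hws ▸ hj)
      have h3 := hcw j hzj
      have hxl : x l ≠ 0 := mem_supp.1 hlx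
      have h4 := mul_pos_of_neg_of_neg h1 h2
      simp only [Pi.smul_apply, smul_eq_mul] at h3 ⊢
      have h5 : 0 < (x l * (c * w l)) * (σ l ^ 2 * σ j ^ 2 * (x j * w j) ^ 2) := by
        linarith [mul_pos h4 h3]
      exact pos_of_mul_pos_left h5 (by positivity)
    · exact hcw l (by rw [← mem_supp, hzs]; simp [hli]; simpa using hlx)
  · have h1 := eq_zero_of_notMem_supp hlx
    have h2 : w l = 0 := eq_zero_of_notMem_supp (by rw [hws]; exact hlx)
    simp [h1, h2]

end Uniform

section Dependences

variable {n m : ℕ}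

/-! ### Affine dependences of a configuration -/

/-- The affine dependences of a labelled configuration. -/
def dependences (A : Fin n → EuclideanSpace ℝ (Fin m)) : Submodule ℝ (Fin n → ℝ) where
  carrier := {x | ∑ i, x i = 0 ∧ ∀ j, ∑ i, x i * A i j = 0}
  add_mem' := fun ha hb => by
    simp only [Set.mem_ofPred_eq, Pi.add_apply, add_mul, Finset.sum_add_distrib] at *
    exact ⟨by rw [ha.1, hb.1, add_zero], fun j => by rw [ha.2 j, hb.2 j, add_zero]⟩
  zero_mem' := by simp
  smul_mem' := fun c _ ha => by
    simp only [Set.mem_ofPred_eq, Pi.smul_apply, smul_eq_mul, mul_assoc, ← Finset.mul_sum] at *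
    exact ⟨by rw [ha.1, mul_zero], fun j => by rw [ha.2 j, mul_zero]⟩

variable {A : Fin n → EuclideanSpace ℝ (Fin m)}

lemma mem_dependences {x : Fin n → ℝ} :
    x ∈ dependences A ↔ ∑ i, x i = 0 ∧ ∑ i, x i • A i = 0 := by
  refine and_congr_right fun _ => ⟨fun h => ?_, fun h j => ?_⟩
  · ext j
    simpa using h j
  · simpa using congrFun (congrArg WithLp.ofLp h) j

lemma sum_inner_of_mem_dependences {x : Fin n → ℝ} (hx : x ∈ dependences A)
    (v : EuclideanSpace ℝ (Fin m)) : ∑ i, x i * inner ℝ (A i) v = 0 := by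
  have := congrArg (fun w => inner ℝ w v) (mem_dependences.1 hx).2
  simpa [sum_inner, inner_smul_left] using this

lemma sum_eq_sum_of_supp_subset {E : Type*} [AddCommMonoid E] [Module ℝ E] {x : Fin n → ℝ}
    {T : Finset (Fin n)} (h : supp x ⊆ T) (f : Fin n → E) :
    ∑ i, x i • f i = ∑ i ∈ T, x i • f i := by
  symm
  apply Finset.sum_subset (Finset.subset_univ T)
  intro i _ hi
  rw [eq_zero_of_notMem_supp (fun h' => hi (h h')), zero_smul]

lemma exists_extension_by_zero (A : Fin n → EuclideanSpace ℝ (Fin m)) {T : Finset (Fin n)}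
    (x : T → ℝ) : ∃ y : Fin n → ℝ, (∀ i : T, y i = x i) ∧ supp y ⊆ T ∧
      ∑ i, y i = ∑ i, x i ∧ ∑ i, y i • A i = ∑ i, x i • A i := by
  classical
  let y : Fin n → ℝ := fun i => if hi : i ∈ T then x ⟨i, hi⟩ else 0
  have hyx : ∀ i : T, y i = x i := fun i => by simp [y]
  have hys : supp y ⊆ T := fun i hi => by
    by_contra hiT
    simp [y, hiT] at hi
  have hsum : ∀ {E : Type} [AddCommMonoid E] [Module ℝ E] (f : Fin n → E),
      ∑ i, y i • f i = ∑ i : T, x i • f i := fun f => by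
    rw [sum_eq_sum_of_supp_subset hys f, ← Finset.sum_coe_sort]
    exact Finset.sum_congr rfl fun i _ => by rw [hyx]
  exact ⟨y, hyx, hys, by simpa using hsum (fun _ => (1 : ℝ)), hsum A⟩

/-- The linear combinations of the homogenized points `(1, A i)` with `i ∈ T`. -/
noncomputable def homogenize (A : Fin n → EuclideanSpace ℝ (Fin m)) (T : Finset (Fin n)) :
    (T → ℝ) →ₗ[ℝ] ℝ × EuclideanSpace ℝ (Fin m) where
  toFun x := (∑ i, x i, ∑ i, x i • A i)
  map_add' x y := by simp [Finset.sum_add_distrib, add_smul]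
  map_smul' c x := by simp [Finset.mul_sum, Finset.smul_sum, mul_smul]

/-- The values on the points `A i`, `i ∈ T`, of the affine functions `c + ⟨·, v⟩`. -/
noncomputable def affineEval (A : Fin n → EuclideanSpace ℝ (Fin m)) (T : Finset (Fin n)) :
    ℝ × EuclideanSpace ℝ (Fin m) →ₗ[ℝ] (T → ℝ) where
  toFun p i := p.1 + inner ℝ (A i) p.2
  map_add' p q := by ext i; simp [inner_add_right]; ring
  map_smul' c p := by ext i; simp [inner_smul_right]; ring

lemma finrank_homogeneous {T : Finset (Fin n)} (hT : T.card = m + 1) :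
    Module.finrank ℝ (T → ℝ) = Module.finrank ℝ (ℝ × EuclideanSpace ℝ (Fin m)) := by
  simp [hT]; omega

/-- If no dependence is supported on `m + 1` points, then any `m + 1` points affinely span. -/
lemma exists_weights (h : ∀ x ∈ dependences A, x ≠ 0 → m + 1 < (supp x).card)
    {T : Finset (Fin n)} (hT : T.card = m + 1) (c : ℝ) (v : EuclideanSpace ℝ (Fin m)) :
    ∃ w : Fin n → ℝ, supp w ⊆ T ∧ ∑ i, w i = c ∧ ∑ i, w i • A i = v := by
  have hinj : Function.Injective (homogenize A T) := by
    rw [← LinearMap.ker_eq_bot, LinearMap.ker_eq_bot']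
    intro x hx
    obtain ⟨y, hyx, hys, h1, h2⟩ := exists_extension_by_zero A x
    have hy : y ∈ dependences A :=
      mem_dependences.2 ⟨h1.trans (congrArg Prod.fst hx), h2.trans (congrArg Prod.snd hx)⟩
    have hy0 : y = 0 := by
      by_contra hne
      have := h y hy hne
      have := Finset.card_le_card hys
      omega
    ext i
    rw [← hyx, hy0]; rfl
  obtain ⟨x, hx⟩ := (LinearMap.injective_iff_surjective_of_finrank_eq_finrank
    (finrank_homogeneous hT)).1 hinj (c, v)
  obtain ⟨y, -, hys, h1, h2⟩ := exists_extension_by_zero A x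
  exact ⟨y, hys, h1.trans (congrArg Prod.fst hx), h2.trans (congrArg Prod.snd hx)⟩

/-- If no dependence is supported on `m + 1` points, then heights over any `m + 1` points are
interpolated by an affine function. -/
lemma exists_affine_interpolation (h : ∀ x ∈ dependences A, x ≠ 0 → m + 1 < (supp x).card)
    {T : Finset (Fin n)} (hT : T.card = m + 1) (f : Fin n → ℝ) :
    ∃ (c : ℝ) (v : EuclideanSpace ℝ (Fin m)), ∀ i ∈ T, c + inner ℝ (A i) v = f i := by
  have hinj : Function.Injective (affineEval A T) := by
    rw [← LinearMap.ker_eq_bot, LinearMap.ker_eq_bot']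
    rintro ⟨c, v⟩ hx
    have hx' : ∀ i ∈ T, c + inner ℝ (A i) v = 0 := fun i hi => congrFun hx ⟨i, hi⟩
    -- Writing `(c, v)` as a combination of the homogenized points shows `c ^ 2 + ‖v‖ ^ 2 = 0`.
    obtain ⟨w, hwT, hwc, hwv⟩ := exists_weights h hT c v
    have h0 : ∑ i, w i * (c + inner ℝ (A i) v) = 0 := by
      apply Finset.sum_eq_zero
      intro i _
      by_cases hi : i ∈ T
      · rw [hx' i hi, mul_zero]
      · rw [eq_zero_of_notMem_supp (fun h' => hi (hwT h')), zero_mul]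
    have h1 : ∑ i, w i * (c + inner ℝ (A i) v) = c * c + inner ℝ v v := by
      have h2 : inner ℝ v v = ∑ i, w i * inner ℝ (A i) v := by
        conv_lhs => enter [2]; rw [← hwv]
        simp [sum_inner, inner_smul_left]
      rw [h2]
      simp only [mul_add, Finset.sum_add_distrib, ← Finset.sum_mul, hwc]
    rw [h1] at h0
    have h2 := mul_self_nonneg c
    have h3 : 0 ≤ inner ℝ v v := real_inner_self_nonneg
    have hc : c = 0 := mul_self_eq_zero.1 (by linarith)
    have hv : v = 0 := (inner_self_eq_zero (𝕜 := ℝ)).1 (by linarith)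
    rw [hc, hv]; rfl
  obtain ⟨⟨c, v⟩, hp⟩ := (LinearMap.injective_iff_surjective_of_finrank_eq_finrank
    (finrank_homogeneous hT).symm).1 hinj (fun i => f i)
  exact ⟨c, v, fun i hi => congrFun hp ⟨i, hi⟩⟩

lemma sum_smul_mem_affineSpan (A : Fin n → EuclideanSpace ℝ (Fin m)) {T : Finset (Fin n)}
    {w : Fin n → ℝ} (hwT : supp w ⊆ T) (hw : ∑ i, w i = 1) :
    ∑ i, w i • A i ∈ affineSpan ℝ (A '' T) := by
  rw [sum_eq_sum_of_supp_subset hwT]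
  have hT1 : ∑ i ∈ T, w i = 1 := by
    have := sum_eq_sum_of_supp_subset hwT (fun _ => (1 : ℝ))
    simp only [smul_eq_mul, mul_one] at this
    rw [← this, hw]
  rw [← Finset.affineCombination_eq_linear_combination T A w hT1]
  exact affineCombination_mem_affineSpan_image hT1 (fun i hi hi' => absurd hi hi') A

lemma affineSpan_eq_top_of_card (h : ∀ x ∈ dependences A, x ≠ 0 → m + 1 < (supp x).card)
    {T : Finset (Fin n)} (hT : T.card = m + 1) : affineSpan ℝ (A '' T) = ⊤ := by
  refine top_unique fun v _ => ?_
  obtain ⟨w, hwT, hwc, rfl⟩ := exists_weights h hT 1 v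
  exact sum_smul_mem_affineSpan A hwT hwc

lemma InGeneralPosition.isUniform (hA : InGeneralPosition A) (hn : m + 1 ≤ n) :
    IsUniform (dependences A) (m + 1) := by
  classical
  constructor
  · intro x hx hne
    by_contra hcard
    obtain ⟨T, hxT, -, hT⟩ := Finset.exists_subsuperset_card_eq (Finset.subset_univ (supp x))
      (not_lt.1 hcard) (by simpa using hn)
    have hinj : Function.Injective (affineEval A T) := by
      rw [← LinearMap.ker_eq_bot, LinearMap.ker_eq_bot']
      rintro ⟨c, v⟩ hx
      have hx' : ∀ i ∈ T, c + inner ℝ (A i) v = 0 := fun i hi => congrFun hx ⟨i, hi⟩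
      have hv : v = 0 := by
        by_contra hv
        obtain ⟨i, hi, hne⟩ := hA T hT v hv (-c)
        exact hne (by linarith [hx' i hi])
      obtain ⟨i, hi⟩ := Finset.card_pos.1 (show 0 < T.card by omega)
      have := hx' i hi
      simp only [hv, inner_zero_right, add_zero] at this
      rw [hv, this]; rfl
    -- The dependence `x` is orthogonal to all values of affine functions, hence to itself.
    obtain ⟨⟨c, v⟩, hp⟩ := (LinearMap.injective_iff_surjective_of_finrank_eq_finrank
      (finrank_homogeneous hT).symm).1 hinj (fun i => x i)
    have hp' : ∀ i ∈ T, c + inner ℝ (A i) v = x i := fun i hi => congrFun hp ⟨i, hi⟩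
    have h0 : ∑ i, x i * (c + inner ℝ (A i) v) = 0 := by
      simp only [mul_add, Finset.sum_add_distrib, ← Finset.sum_mul]
      rw [(mem_dependences.1 hx).1, sum_inner_of_mem_dependences hx]; simp
    have h1 : ∑ i, x i * (c + inner ℝ (A i) v) = ∑ i, x i * x i := by
      apply Finset.sum_congr rfl
      intro i _
      by_cases hi : i ∈ T
      · rw [hp' i hi]
      · rw [eq_zero_of_notMem_supp (fun h' => hi (hxT h'))]; simp
    rw [h1, Finset.sum_eq_zero_iff_of_nonneg (fun i _ => mul_self_nonneg _)] at h0
    exact hne (funext fun i => by simpa using h0 i (Finset.mem_univ i))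
  · intro T hT
    have hker : LinearMap.ker (homogenize A T) ≠ ⊥ :=
      LinearMap.ker_ne_bot_of_finrank_lt (by simp; omega)
    obtain ⟨x, hx, hx0⟩ := (Submodule.ne_bot_iff _).1 hker
    obtain ⟨y, hyx, hys, h1, h2⟩ := exists_extension_by_zero A x
    refine ⟨y, mem_dependences.2 ⟨h1.trans (congrArg Prod.fst hx), h2.trans (congrArg Prod.snd hx)⟩,
      fun hy0 => hx0 (funext fun i => by rw [← hyx, hy0]; rfl), hys⟩

/-! ### Faces and dependences -/

/-- Gale duality for faces: `S` is the label set of a face exactly if no dependence is nonnegative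
and nonzero outside `S`. -/
lemma mem_faceLabels_iff {S : Set (Fin n)} :
    S ∈ faceLabels A ↔ ∀ x ∈ dependences A, (∀ i ∉ S, 0 ≤ x i) → ∀ i ∉ S, x i = 0 := by
  classical
  constructor
  · rintro ⟨F, hF, rfl⟩ x hx hpos i hi
    -- A function vanishing on the face and positive on the remaining points.
    obtain ⟨f, hf0, hf1, hf2⟩ : ∃ f : Fin n → ℝ, (∑ i, x i * f i = 0) ∧ (∀ i, A i ∈ F → f i = 0) ∧
        ∀ i, A i ∉ F → 0 < f i := by
      rcases F.eq_empty_or_nonempty with rfl | hne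
      · exact ⟨fun _ => 1, by simpa using (mem_dependences.1 hx).1, by simp, by simp⟩
      · obtain ⟨l, rfl⟩ := hF hne
        obtain ⟨x₀, hx₀, hmax⟩ := hne
        have hmem : ∀ i, A i ∈ convexHull ℝ (Set.range A) := fun i =>
          subset_convexHull ℝ _ (Set.mem_range_self i)
        refine ⟨fun i => l x₀ - l (A i), ?_, ?_, ?_⟩
        · have := congrArg l (mem_dependences.1 hx).2
          simp only [map_sum, map_smul, smul_eq_mul, map_zero] at this
          simp only [mul_sub, Finset.sum_sub_distrib, this, ← Finset.sum_mul,
            (mem_dependences.1 hx).1]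
          simp
        · rintro i ⟨-, hi⟩
          have h1 := hi x₀ hx₀
          have h2 := hmax (A i) (hmem i)
          change l x₀ - l (A i) = 0
          linarith
        · intro i hi
          by_contra hle
          refine hi ⟨hmem i, fun y hy => ?_⟩
          have h1 := hmax y hy
          linarith
    have hnn : ∀ i ∈ Finset.univ, 0 ≤ x i * f i := by
      intro i _
      by_cases hi : A i ∈ F
      · rw [hf1 i hi, mul_zero]
      · exact mul_nonneg (hpos i hi) (hf2 i hi).le
    have := (Finset.sum_eq_zero_iff_of_nonneg hnn).1 hf0 i (Finset.mem_univ i)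
    exact (mul_eq_zero.1 this).resolve_right (hf2 i hi).ne'
  · intro h
    rcases S.eq_empty_or_nonempty with rfl | ⟨s₀, hs₀⟩
    · exact ⟨∅, fun hne => absurd hne (by simp), by simp⟩
    -- Separate the homogenized points outside `S` from the linear span of those in `S`.
    let a : Fin n → ℝ × EuclideanSpace ℝ (Fin m) := fun i => (1, A i)
    let Y : Submodule ℝ (ℝ × EuclideanSpace ℝ (Fin m)) := Submodule.span ℝ (a '' S)
    have hdisj : Disjoint (convexHull ℝ (a '' Sᶜ)) (Y : Set _) := by
      rw [Set.disjoint_left]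
      intro p hp hpY
      let Θ : (Fin n → ℝ) →ₗ[ℝ] ℝ × EuclideanSpace ℝ (Fin m) := Fintype.linearCombination ℝ a
      have hΘ : ∀ w, Θ w = ∑ i, w i • a i := fun w => Fintype.linearCombination_apply ..
      obtain ⟨w, ⟨hw0, hw1, hwS⟩, hwp⟩ : p ∈ Θ '' {w | (∀ i, 0 ≤ w i) ∧ ∑ i, w i = 1 ∧
          ∀ i ∈ S, w i = 0} := by
        refine convexHull_min ?_ (Convex.linear_image ?_ Θ) hp
        · rintro _ ⟨i, hi, rfl⟩
          refine ⟨Pi.single i 1, ⟨fun j => ?_, by simp, fun j hj => ?_⟩, ?_⟩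
          · simp only [Pi.single_apply]; split_ifs <;> simp
          · rw [Pi.single_apply, if_neg]; rintro rfl; exact hi hj
          · simp [hΘ, Pi.single_apply, ite_smul]
        · intro x hx y hy s t hs ht hst
          refine ⟨fun i => ?_, ?_, fun i hi => ?_⟩
          · have := hx.1 i
            have := hy.1 i
            simp only [Pi.add_apply, Pi.smul_apply, smul_eq_mul]; positivity
          · simp only [Pi.add_apply, Pi.smul_apply, smul_eq_mul, Finset.sum_add_distrib,
              ← Finset.mul_sum, hx.2.1, hy.2.1, mul_one, hst]
          · simp [hx.2.2 i hi, hy.2.2 i hi]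
      rw [SetLike.mem_coe, Finsupp.mem_span_image_iff_linearCombination] at hpY
      obtain ⟨l, hl, hlp⟩ := hpY
      rw [Finsupp.linearCombination_apply, Finsupp.sum_fintype _ _ (by simp)] at hlp
      have hlS : ∀ i ∉ S, l i = 0 := fun i hi =>
        Finsupp.notMem_support_iff.1 fun h' => hi (hl h')
      have hdiff : ∑ i, (w i - l i) • a i = 0 := by
        simp only [sub_smul, Finset.sum_sub_distrib, hlp, ← hΘ, hwp, sub_self]
      have hmem : (fun i => w i - l i) ∈ dependences A := by
        rw [mem_dependences]
        have h1 := congrArg Prod.fst hdiff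
        have h2 := congrArg Prod.snd hdiff
        simp only [a, Prod.fst_sum, Prod.snd_sum, Prod.smul_mk, smul_eq_mul, mul_one] at h1 h2
        exact ⟨h1, h2⟩
      have hw' : ∀ i, w i = 0 := fun i => by
        by_cases hi : i ∈ S
        · exact hwS i hi
        · have := h _ hmem (fun i hi => by simpa [hlS i hi] using hw0 i) i hi
          simpa [hlS i hi] using this
      simp [hw'] at hw1
    have hcpt : IsCompact (convexHull ℝ (a '' Sᶜ)) :=
      (Set.toFinite _).isCompact_convexHull (𝕜 := ℝ)
    obtain ⟨f, u, v, hfu, huv, hfv⟩ := geometric_hahn_banach_compact_closed (convex_convexHull ℝ _)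
      hcpt Y.convex Y.closed_of_finiteDimensional hdisj
    have hfY : ∀ y ∈ Y, f y = 0 := by
      intro y hy
      by_contra hne
      have h1 := hfv (((v - 1) / f y) • y) (Y.smul_mem _ hy)
      rw [map_smul, smul_eq_mul, div_mul_cancel₀ _ hne] at h1
      linarith
    have hv0 : v < 0 := by simpa using hfv 0 Y.zero_mem
    have hneg : ∀ i ∉ S, f (a i) < 0 := fun i hi =>
      ((hfu _ (subset_convexHull ℝ _ ⟨i, hi, rfl⟩)).trans huv).trans hv0
    have hzero : ∀ i ∈ S, f (a i) = 0 := fun i hi => hfY _ (Submodule.subset_span ⟨i, hi, rfl⟩)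
    let l : StrongDual ℝ (EuclideanSpace ℝ (Fin m)) := f.comp (ContinuousLinearMap.inr ℝ ℝ _)
    have hl : ∀ i, l (A i) = f (a i) - f (1, 0) := fun i => by
      rw [← map_sub]; simp [l, a]
    have hle : ∀ y ∈ convexHull ℝ (Set.range A), l y ≤ l (A s₀) := by
      intro y hy
      have : convexHull ℝ (Set.range A) ⊆ {y | l y ≤ l (A s₀)} := by
        apply convexHull_min _ (convex_halfSpace_le l.isLinear _)
        rintro _ ⟨i, rfl⟩
        change l (A i) ≤ l (A s₀)
        rw [hl, hl, hzero s₀ hs₀]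
        by_cases hi : i ∈ S
        · rw [hzero i hi]
        · linarith [hneg i hi]
      exact this hy
    refine ⟨{x ∈ convexHull ℝ (Set.range A) | ∀ y ∈ convexHull ℝ (Set.range A), l y ≤ l x},
      fun _ => ⟨l, rfl⟩, ?_⟩
    ext i
    have hmem : ∀ i, A i ∈ convexHull ℝ (Set.range A) := fun i =>
      subset_convexHull ℝ _ (Set.mem_range_self i)
    constructor
    · intro hi
      refine ⟨hmem i, fun y hy => (hle y hy).trans_eq ?_⟩
      rw [hl, hl, hzero i hi, hzero s₀ hs₀]
    · rintro ⟨-, hi⟩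
      by_contra hiS
      have := hi _ (hmem s₀)
      rw [hl, hl, hzero s₀ hs₀] at this
      linarith [hneg i hiS]

/-- For uniform configurations circuits suffice to recognize faces. -/
lemma mem_faceLabels_iff_circuit {r : ℕ} (hA : IsUniform (dependences A) r) {S : Set (Fin n)} :
    S ∈ faceLabels A ↔
      ∀ x, IsCircuit (dependences A) r x → (∀ i ∉ S, 0 ≤ x i) → ∀ i ∉ S, x i = 0 := by
  rw [mem_faceLabels_iff]
  refine ⟨fun h x hx => h x hx.mem, fun h x hx hpos i hi => ?_⟩
  by_contra hxi
  obtain ⟨y, hy, hyi, hyx⟩ := hA.exists_conformal_circuit hx hxi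
  refine hyi (h y hy (fun j hj => ?_) i hi)
  by_contra hneg
  have h1 := hyx j (by linarith)
  nlinarith [hpos j hj]

lemma faceLabels_subset_of_circuitSignsLE {m' r : ℕ} {A' : Fin n → EuclideanSpace ℝ (Fin m')}
    (hA : IsUniform (dependences A) r) (hA' : IsUniform (dependences A') r)
    (h : CircuitSignsLE (dependences A) (dependences A') r) : faceLabels A' ⊆ faceLabels A := by
  intro S hS
  rw [mem_faceLabels_iff_circuit hA'] at hS
  rw [mem_faceLabels_iff_circuit hA]
  intro x hx hpos i hi
  obtain ⟨y, hy, hxy⟩ := h x hx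
  have h0 := hS y hy (fun j hj => by
    have := hpos j hj
    rwa [← sign_nonneg_iff, ← hxy j, sign_nonneg_iff]) i hi
  rw [← sign_eq_zero_iff, hxy i, h0, sign_zero]

/-- A uniform configuration all of whose points are faces is the vertex set of a polytope. -/
lemma isPolytopeVertices_of_isUniform (hA : IsUniform (dependences A) (m + 1)) (hn : m + 1 ≤ n)
    (hm : 1 ≤ m) (hface : ∀ i, {i} ∈ faceLabels A) : IsPolytopeVertices A := by
  classical
  refine ⟨fun i j hij => ?_, ?_, ?_⟩
  · by_contra hne
    have hmem : Pi.single i 1 - Pi.single j 1 ∈ dependences A := by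
      rw [mem_dependences]
      simp [Pi.single_apply, sub_smul, ite_smul, hij]
    have h0 := hA.eq_zero hmem (by
      have : supp (Pi.single i 1 - Pi.single j 1 : Fin n → ℝ) ⊆ {i, j} := by
        intro l hl
        by_contra hl'
        simp only [Finset.mem_insert, Finset.mem_singleton, not_or] at hl'
        simp [hl'.1, hl'.2] at hl
      have := (Finset.card_le_card this).trans Finset.card_le_two
      omega)
    have := congrFun h0 i
    simp [hne] at this
  · apply Set.Subset.antisymm extremePoints_convexHull_subset
    rintro _ ⟨i, rfl⟩
    obtain ⟨F, hF, hiF⟩ := hface i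
    have hAi : A i ∈ F := by
      have : i ∈ A ⁻¹' F := by rw [← hiF]; rfl
      exact this
    have hcpt : IsCompact F := hF.isCompact ((Set.finite_range A).isCompact_convexHull (𝕜 := ℝ))
    obtain ⟨y, hy⟩ := hcpt.extremePoints_nonempty ⟨_, hAi⟩
    have hy' := hF.isExtreme.extremePoints_subset_extremePoints hy
    obtain ⟨j, rfl⟩ := extremePoints_convexHull_subset hy'
    have hj : j ∈ A ⁻¹' F := (extremePoints_subset hy : A j ∈ F)
    rw [← hiF] at hj
    rwa [show i = j from hj.symm]
  · obtain ⟨T, -, hT⟩ := Finset.exists_subset_card_eq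
      (show m + 1 ≤ (Finset.univ : Finset (Fin n)).card by simpa using hn)
    exact top_unique ((affineSpan_eq_top_of_card hA.lt_card hT).symm.le.trans
      (affineSpan_mono ℝ (Set.image_subset_range A T)))

end Dependences

section Lifting

variable {n m : ℕ}

/-! ### Lexicographic liftings and their dependences -/

section

variable {A : Fin n → EuclideanSpace ℝ (Fin m)} {B : Fin n → EuclideanSpace ℝ (Fin (m + 1))}

lemma dependences_eq_slice (h : ∀ i (j : Fin m), B i j.castSucc = A i j) :
    dependences B = slice (dependences A) (height B) := by
  ext x
  change (_ ∧ ∀ j, _) ↔ (_ ∧ ∀ j, _) ∧ _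
  rw [Fin.forall_fin_succ', and_assoc]
  simp only [h, dotProduct, height, mul_comm]

/-- The sign of the height of a lifted point, with the value `1` at height zero. -/
noncomputable def heightSign (B : Fin n → EuclideanSpace ℝ (Fin (m + 1))) (i : Fin n) : ℝ :=
  if height B i < 0 then -1 else 1

lemma heightSign_eq_one_or (B : Fin n → EuclideanSpace ℝ (Fin (m + 1))) (i : Fin n) :
    heightSign B i = 1 ∨ heightSign B i = -1 := by
  unfold heightSign; split_ifs <;> simp

/-- The normal vector of the graph of `x ↦ c + ⟨x, v⟩`, with last coordinate `1`. -/
noncomputable def graphNormal (v : EuclideanSpace ℝ (Fin m)) : EuclideanSpace ℝ (Fin (m + 1)) :=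
  WithLp.toLp 2 (Fin.snoc (fun j => -v j) 1)

lemma inner_graphNormal {p : EuclideanSpace ℝ (Fin (m + 1))} {a : EuclideanSpace ℝ (Fin m)}
    (h : ∀ j : Fin m, p j.castSucc = a j) (v : EuclideanSpace ℝ (Fin m)) :
    inner ℝ p (graphNormal v) = p (Fin.last m) - inner ℝ a v := by
  simp only [PiLp.inner_apply, Fin.sum_univ_castSucc, graphNormal, Fin.snoc_castSucc,
    Fin.snoc_last, h]
  simp
  ring

/-- The graph of the affine function interpolating heights over `m + 1` points is spanned by the
lifted points. -/
lemma affineSpan_lift_eq_hyperplane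
    (hA : ∀ x ∈ dependences A, x ≠ 0 → m + 1 < (supp x).card)
    (h : ∀ i (j : Fin m), B i j.castSucc = A i j) {T : Finset (Fin n)} (hT : T.card = m + 1)
    {c : ℝ} {v : EuclideanSpace ℝ (Fin m)} (hcv : ∀ i ∈ T, c + inner ℝ (A i) v = height B i) :
    (affineSpan ℝ (B '' T) : Set (EuclideanSpace ℝ (Fin (m + 1)))) =
      hyperplane (graphNormal v) c := by
  apply Set.Subset.antisymm
  · intro x hx
    refine affineSpan_induction (p := fun y => inner ℝ y (graphNormal v) = c) hx ?_ ?_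
    · rintro _ ⟨i, hi, rfl⟩
      rw [inner_graphNormal (h i)]
      have := hcv i hi
      unfold height at this
      linarith
    · intro s a b e ha hb he
      change inner ℝ (s • (a - b) + e) _ = c
      rw [inner_add_left, real_inner_smul_left, inner_sub_left, ha, hb, he]
      ring
  · intro x hx
    change inner ℝ x _ = c at hx
    let a : EuclideanSpace ℝ (Fin m) := WithLp.toLp 2 fun j => x j.castSucc
    rw [inner_graphNormal (a := a) (fun j => rfl)] at hx
    obtain ⟨w, hwT, hw1, hwa⟩ := exists_weights hA hT 1 a
    have hcoord : ∀ {l : ℕ} (D : Fin n → EuclideanSpace ℝ (Fin l)) (j : Fin l),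
        (∑ i, w i • D i) j = ∑ i, w i * D i j := fun D j => by simp
    have hlast : ∑ i, w i * height B i = c + inner ℝ a v := by
      have h1 : ∑ i, w i * height B i = ∑ i, w i * (c + inner ℝ (A i) v) := by
        apply Finset.sum_congr rfl
        intro i _
        by_cases hi : i ∈ T
        · rw [hcv i hi]
        · rw [eq_zero_of_notMem_supp (fun h' => hi (hwT h'))]; simp
      rw [h1, ← hwa, sum_inner]
      simp only [mul_add, Finset.sum_add_distrib, ← Finset.sum_mul, hw1, inner_smul_left]
      simp
    have hx' : x = ∑ i, w i • B i := by
      ext j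
      rw [hcoord]
      induction j using Fin.lastCases with
      | last =>
        change _ = ∑ i, w i * height B i
        rw [hlast]; linarith
      | cast j =>
        simp only [h]
        rw [← hcoord A, hwa]
    rw [hx']
    exact sum_smul_mem_affineSpan B hwT hw1

/-- The geometric condition on a lexicographic lifting, read off on affine dependences. -/
lemma IsLexLifting.isLexHeight (hB : IsLexLifting A B)
    (hA : IsUniform (dependences A) (m + 1)) :
    IsLexHeight (dependences A) (m + 1) (heightSign B) (height B) := by
  classical
  intro x hx i hi
  have hcard : ((supp x).erase i).card = m + 1 := by
    rw [Finset.card_erase_of_mem hi.1, hx.card_supp]; rfl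
  obtain ⟨c, v, hcv⟩ := exists_affine_interpolation hA.lt_card hcard (height B)
  have hspan : IsSpannedBy (hyperplane (graphNormal v) c) (B '' {j | j < i}) :=
    ⟨B '' ((supp x).erase i), Set.image_mono fun j hj =>
      lt_of_le_of_ne (hi.2 j (Finset.mem_of_mem_erase hj)) (Finset.ne_of_mem_erase hj),
      affineSpan_lift_eq_hyperplane hA.lt_card hB.1 hcard hcv⟩
  have hlast : 0 < graphNormal v (Fin.last m) := by simp [graphNormal]
  have hdot : height B ⬝ᵥ x = x i * (height B i - c - inner ℝ (A i) v) := by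
    have h0 : ∑ j, x j * (c + inner ℝ (A j) v) = 0 := by
      simp only [mul_add, Finset.sum_add_distrib, ← Finset.sum_mul]
      rw [(mem_dependences.1 hx.mem).1, sum_inner_of_mem_dependences hx.mem]; simp
    have h1 : height B ⬝ᵥ x = ∑ j, x j * (height B j - (c + inner ℝ (A j) v)) := by
      simp only [mul_sub, Finset.sum_sub_distrib, h0, sub_zero, dotProduct, mul_comm]
    rw [h1, Finset.sum_eq_single i]
    · ring
    · intro j _ hji
      by_cases hj : j ∈ supp x
      · rw [hcv j (Finset.mem_erase.2 ⟨hji, hj⟩)]; ring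
      · rw [eq_zero_of_notMem_supp hj, zero_mul]
    · simp
  have hxi : x i ≠ 0 := mem_supp.1 hi.1
  obtain ⟨hne, habove, hbelow⟩ := hB.2 i (by have := hi.le_val; rw [hx.card_supp] at this; omega)
  have hval := inner_graphNormal (hB.1 i) v
  have hx2 : 0 < x i ^ 2 := by positivity
  rw [hdot]
  unfold heightSign
  unfold height at *
  split_ifs with hs
  · have := hbelow hs _ _ hlast hspan
    rw [hval] at this
    nlinarith
  · have := habove (lt_of_le_of_ne (not_lt.1 hs) hne.symm) _ _ hlast hspan
    rw [hval] at this
    nlinarith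

lemma IsPositiveLexLifting.heightSign_eq (hB : IsPositiveLexLifting A B) :
    heightSign B = 1 :=
  funext fun i => if_neg (not_lt.2 (hB.2 i))

end

/-! ### Neighborliness of the double lifting -/

/-- A proper face of a uniform configuration is a simplex. -/
lemma card_lt_of_mem_faceLabels {r : ℕ} {A : Fin n → EuclideanSpace ℝ (Fin m)}
    (hA : IsUniform (dependences A) r) {S : Finset (Fin n)} (hS : (S : Set (Fin n)) ∈ faceLabels A)
    {a : Fin n} (ha : a ∉ S) : S.card < r + 1 := by
  classical
  by_contra hcard
  obtain ⟨T, hTS, hT⟩ := Finset.exists_subset_card_eq (show r ≤ S.card by omega)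
  have haT : a ∉ T := fun h => ha (hTS h)
  obtain ⟨x, hx, hxs⟩ := hA.exists_circuit (T := insert a T)
    (by rw [Finset.card_insert_of_notMem haT, hT])
  have hxa : x a ≠ 0 := by rw [← mem_supp, hxs]; simp
  have h0 := mem_faceLabels_iff.1 hS (x a • x) ((dependences A).smul_mem _ hx.mem) (by
    intro i hi
    by_cases hia : i = a
    · subst hia; simpa using mul_self_nonneg (x i)
    · have : x i = 0 := eq_zero_of_notMem_supp (by
        rw [hxs, Finset.mem_insert, not_or]
        exact ⟨hia, fun h => hi (hTS h)⟩)
      simp [this]) a ha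
  simp [hxa] at h0

/-- A circuit of a double lifting, the second one positive, is a circuit of the original
configuration with one positive and one negative element added, which makes the configuration
neighborly of one degree more. -/
lemma isKNeighborly_of_double_slice {m' k r : ℕ} {A : Fin n → EuclideanSpace ℝ (Fin m)}
    {C : Fin n → EuclideanSpace ℝ (Fin m')} (hA : IsUniform (dependences A) r)
    {σ h g : Fin n → ℝ} (hh : IsLexHeight (dependences A) r σ h)
    (hg : IsLexHeight (slice (dependences A) h) (r + 1) 1 g)
    (hC : dependences C = slice (slice (dependences A) h) g) (hk : IsKNeighborly k A) :
    IsKNeighborly (k + 1) C := by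
  classical
  intro S hS
  have hL' := hh.isUniform_slice hA
  have hU : IsUniform (dependences C) (r + 2) := hC ▸ hg.isUniform_slice hL'
  rw [mem_faceLabels_iff_circuit hU, hC]
  intro x hx hpos
  exfalso
  obtain ⟨i, hi⟩ := exists_isLast hx.supp_nonempty
  obtain ⟨y, hy, hys, hxy, -⟩ := hg.exists_circuit_of_slice hL' hx hi
  obtain ⟨j, hj⟩ := exists_isLast hy.supp_nonempty
  obtain ⟨z, hz, hzs, hyz, -⟩ := hh.exists_circuit_of_slice hA hy hj
  have hij := hg.last_two_signs hL' hx hi (hys ▸ hj)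
  simp only [Pi.one_apply, one_mul] at hij
  obtain ⟨b, hb, hxb⟩ : ∃ b, z b = 0 ∧ x b < 0 := by
    have hzi : z i = 0 := eq_zero_of_notMem_supp (by simp [hzs, hys])
    have hzj : z j = 0 := eq_zero_of_notMem_supp (by simp [hzs])
    rcases mul_neg_iff.1 hij with h' | h'
    · exact ⟨j, hzj, h'.2⟩
    · exact ⟨i, hzi, h'.1⟩
  have hbS : b ∈ S := by
    by_contra hb'
    exact absurd (hpos b hb') (not_le.2 hxb)
  have hcard : (S.erase b).card = k := by rw [Finset.card_erase_of_mem hbS, hS]; rfl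
  have hface := hk _ hcard
  have hz0 := mem_faceLabels_iff.1 hface z hz.mem (by
    intro l hl
    by_contra hneg
    push Not at hneg
    have hyl : y l ≠ 0 := by
      have : l ∈ (supp y).erase j := by rw [← hzs, mem_supp]; exact hneg.ne
      exact mem_supp.1 (Finset.mem_of_mem_erase this)
    have h1 := hyz l hneg.ne
    have h2 := hxy l hyl
    have hxl : x l < 0 := by
      have h3 : y l < 0 := neg_of_mul_pos_left h1 hneg.le
      exact neg_of_mul_pos_left h2 h3.le
    have hlS : l ∈ S := by
      by_contra hl'
      exact absurd (hpos l hl') (not_le.2 hxl)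
    have hlb : l ≠ b := by rintro rfl; exact hneg.ne hb
    exact hl (by simpa using ⟨hlS, hlb⟩))
  have hsub : supp z ⊆ S.erase b := by
    intro l hl
    by_contra hl'
    exact (mem_supp.1 hl) (hz0 l (by exact_mod_cast hl'))
  have h1 := Finset.card_le_card hsub
  have h2 := card_lt_of_mem_faceLabels hA hface (Finset.notMem_erase b S)
  rw [hz.card_supp] at h1
  omega

lemma isKNeighborly_zero (A : Fin n → EuclideanSpace ℝ (Fin m)) : IsKNeighborly 0 A := by
  intro S hS
  rw [Finset.card_eq_zero.1 hS]
  exact ⟨∅, fun h => absurd h (by simp), by simp⟩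

/-! ### Rescaled subspaces -/

section Rescale

variable {L L' : Submodule ℝ (Fin n → ℝ)} {s : Fin n → ℝ} {r : ℕ}

lemma supp_mul_of_pos (hs : ∀ i, 0 < s i) (x : Fin n → ℝ) : supp (s * x) = supp x := by
  ext i; simp [(hs i).ne']

lemma inv_mul_mem_of_rescale (hs : ∀ i, 0 < s i) (h : ∀ x, x ∈ L' ↔ s * x ∈ L) {x : Fin n → ℝ}
    (hx : x ∈ L) : s⁻¹ * x ∈ L' := by
  rw [h]
  convert hx using 1
  ext i
  simp [(hs i).ne']

lemma IsUniform.rescale (hL : IsUniform L r) (hs : ∀ i, 0 < s i)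
    (h : ∀ x, x ∈ L' ↔ s * x ∈ L) : IsUniform L' r := by
  have hs' : ∀ i, 0 < s⁻¹ i := fun i => by simpa using hs i
  constructor
  · intro x hx hne
    rw [← supp_mul_of_pos hs x]
    refine hL.lt_card _ ((h x).1 hx) fun h0 => hne (funext fun i => ?_)
    simpa [(hs i).ne'] using congrFun h0 i
  · intro T hT
    obtain ⟨x, hx, hne, hxT⟩ := hL.exists_mem T hT
    refine ⟨s⁻¹ * x, inv_mul_mem_of_rescale hs h hx, fun h0 => hne (funext fun i => ?_), ?_⟩
    · simpa [(hs i).ne'] using congrFun h0 i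
    · rwa [supp_mul_of_pos hs']

lemma circuitSignsLE_rescale (hs : ∀ i, 0 < s i) (h : ∀ x, x ∈ L' ↔ s * x ∈ L) :
    CircuitSignsLE L L' r ∧ CircuitSignsLE L' L r := by
  have hs' : ∀ i, 0 < s⁻¹ i := fun i => by simpa using hs i
  constructor
  · intro x hx
    refine ⟨s⁻¹ * x, ⟨inv_mul_mem_of_rescale hs h hx.mem, ?_⟩, fun i => ?_⟩
    · rw [supp_mul_of_pos hs', hx.card_supp]
    · rw [Pi.mul_apply, sign_mul, sign_pos (hs' i), one_mul]
  · intro x hx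
    refine ⟨s * x, ⟨(h x).1 hx.mem, ?_⟩, fun i => ?_⟩
    · rw [supp_mul_of_pos hs, hx.card_supp]
    · rw [Pi.mul_apply, sign_mul, sign_pos (hs i), one_mul]

lemma CircuitSignsLE.refl (L : Submodule ℝ (Fin n → ℝ)) (r : ℕ) : CircuitSignsLE L L r :=
  fun x hx => ⟨x, hx, fun _ => rfl⟩

lemma CircuitSignsLE.trans {L₁ L₂ L₃ : Submodule ℝ (Fin n → ℝ)} (h : CircuitSignsLE L₁ L₂ r)
    (h' : CircuitSignsLE L₂ L₃ r) : CircuitSignsLE L₁ L₃ r := by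
  intro x hx
  obtain ⟨y, hy, hxy⟩ := h x hx
  obtain ⟨z, hz, hyz⟩ := h' y hy
  exact ⟨z, hz, fun i => (hxy i).trans (hyz i)⟩

end Rescale

/-! ### Construction of lexicographic heights -/

lemma dotProduct_congr_of_supp {g g' x : Fin n → ℝ} (h : ∀ i ∈ supp x, g i = g' i) :
    g ⬝ᵥ x = g' ⬝ᵥ x := by
  apply Finset.sum_congr rfl
  intro i _
  by_cases hi : i ∈ supp x
  · rw [h i hi]
  · rw [eq_zero_of_notMem_supp hi, mul_zero, mul_zero]

lemma dotProduct_update (g x : Fin n → ℝ) (i : Fin n) (z : ℝ) :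
    Function.update g i z ⬝ᵥ x = g ⬝ᵥ x + (z - g i) * x i := by
  have : Function.update g i z = g + Pi.single i (z - g i) := by
    ext j
    by_cases hj : j = i
    · subst hj; simp
    · simp [hj]
  rw [this, add_dotProduct, single_dotProduct]

/-- Recursive choice of the values of a function on `Fin n`, each value subject to a condition
that involves only the values up to it. -/
lemma exists_of_forall_update {Q : Fin n → (Fin n → ℝ) → Prop}
    (hloc : ∀ i h h', (∀ l ≤ i, h l = h' l) → Q i h → Q i h')
    (hstep : ∀ i h, (∀ l < i, Q l h) → ∃ y, Q i (Function.update h i y)) :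
    ∃ h, ∀ i, Q i h := by
  suffices ∀ k : ℕ, ∃ h, ∀ i : Fin n, (i : ℕ) < k → Q i h by
    obtain ⟨h, hh⟩ := this n
    exact ⟨h, fun i => hh i i.2⟩
  intro k
  induction k with
  | zero => exact ⟨0, fun i hi => absurd hi (by omega)⟩
  | succ k ih =>
    obtain ⟨h, hh⟩ := ih
    by_cases hk : k < n
    · obtain ⟨y, hy⟩ := hstep ⟨k, hk⟩ h fun l hl => hh l hl
      refine ⟨Function.update h ⟨k, hk⟩ y, fun i hi => ?_⟩
      rcases Nat.lt_succ_iff_lt_or_eq.1 hi with h' | h'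
      · refine hloc i h _ (fun l hl => ?_) (hh i h')
        rw [Function.update_of_ne]
        rintro rfl
        exact absurd hl (not_le.2 h')
      · rwa [show i = ⟨k, hk⟩ from Fin.ext h']
    · exact ⟨h, fun i _ => hh i (by omega)⟩

open Filter in
/-- If the second heights are superlinear functions `G i` of the first heights, then first heights
growing fast enough make both lexicographic. -/
lemma exists_lexHeights {L : Submodule ℝ (Fin n → ℝ)} {r : ℕ} (hL : IsUniform L r)
    (σ : Fin n → ℝ) (hσ : ∀ i, σ i = 1 ∨ σ i = -1) (G : Fin n → ℝ → ℝ)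
    (hG : ∀ i (a b : ℝ), ∀ᶠ y in atTop, 0 < G i (σ i * y) + a * y + b) :
    ∃ h, IsLexHeight L r σ h ∧ IsLexHeight (slice L h) (r + 1) 1 fun i => G i (h i) := by
  classical
  let Q : Fin n → (Fin n → ℝ) → Prop := fun i h =>
    (∀ x, IsCircuit L r x → IsLast (supp x) i → 0 < σ i * x i * (h ⬝ᵥ x)) ∧
    ∀ x, IsCircuit (slice L h) (r + 1) x → IsLast (supp x) i →
      0 < x i * ((fun l => G l (h l)) ⬝ᵥ x)
  suffices ∃ h, ∀ i, Q i h by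
    obtain ⟨h, hh⟩ := this
    exact ⟨h, fun x hx i hi => (hh i).1 x hx hi, fun x hx i hi => by
      simpa using (hh i).2 x hx hi⟩
  apply exists_of_forall_update
  · rintro i h h' heq ⟨h1, h2⟩
    have hdot : ∀ x, IsLast (supp x) i → h ⬝ᵥ x = h' ⬝ᵥ x := fun x hi =>
      dotProduct_congr_of_supp fun l hl => heq l (hi.2 l hl)
    refine ⟨fun x hx hi => ?_, fun x hx hi => ?_⟩
    · rw [← hdot x hi]; exact h1 x hx hi
    · have := h2 x ⟨⟨hx.mem.1, (hdot x hi).trans hx.mem.2⟩, hx.card_supp⟩ hi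
      rwa [dotProduct_congr_of_supp (g' := fun l => G l (h' l))] at this
      intro l hl
      simp only [heq l (hi.2 l hl)]
  · intro i h hlt
    have hσ2 : σ i * σ i = 1 := by rcases hσ i with h' | h' <;> simp [h']
    have hGup : ∀ z, (fun l => G l (Function.update h i z l)) =
        Function.update (fun l => G l (h l)) i (G i z) := by
      intro z
      ext l
      by_cases hl : l = i
      · subst hl; simp
      · simp [hl]
    have hfst : ∀ᶠ y in atTop, ∀ T : Finset (Fin n), IsLast T i → ∀ x, IsCircuit L r x →
        supp x = T → 0 < σ i * x i * (Function.update h i (σ i * y) ⬝ᵥ x) := by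
      rw [eventually_all]
      intro T
      by_cases hT : IsLast T i ∧ T.card = r + 1
      · obtain ⟨u, hu, hus⟩ := hL.exists_circuit hT.2
        have hui : u i ≠ 0 := by rw [← mem_supp, hus]; exact hT.1.1
        filter_upwards [eventually_gt_atTop (-(σ i * (h ⬝ᵥ u - h i * u i) / u i))] with y hy _ x hx hxT
        have hxi : x i ≠ 0 := by rw [← mem_supp, hxT]; exact hT.1.1
        rw [dotProduct_update]
        have heq := hL.eq_smul hu hx.mem (hxT.trans hus.symm).subset hui
        have hhx : h ⬝ᵥ x = x i / u i * (h ⬝ᵥ u) := by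
          conv_lhs => rw [heq]
          rw [dotProduct_smul, smul_eq_mul]
        have : σ i * x i * (h ⬝ᵥ x + (σ i * y - h i) * x i)
            = x i ^ 2 * ((σ i * σ i) * y + σ i * (h ⬝ᵥ u - h i * u i) / u i) := by
          rw [hhx]; field_simp; ring
        rw [this, hσ2, one_mul]
        have : 0 < x i ^ 2 := by positivity
        exact mul_pos this (by linarith)
      · exact Eventually.of_forall fun y hl x hx hxT =>
          absurd ⟨hl, hxT ▸ hx.card_supp⟩ hT
    have hsnd : ∀ᶠ y in atTop, ∀ T : Finset (Fin n), IsLast T i → ∀ x,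
        IsCircuit (slice L (Function.update h i (σ i * y))) (r + 1) x → supp x = T →
        0 < x i * ((fun l => G l (Function.update h i (σ i * y) l)) ⬝ᵥ x) := by
      rw [eventually_all]
      intro T
      by_cases hT : IsLast T i ∧ T.card = r + 2
      · have hcard : ∀ j ∈ T, (T.erase j).card = r + 1 := fun j hj => by
          rw [Finset.card_erase_of_mem hj, hT.2]; rfl
        -- The dependences supported on `T` are spanned by `u`, which avoids `i`, and `w`.
        obtain ⟨u, hu, hus⟩ := hL.exists_circuit (hcard i hT.1.1)
        obtain ⟨j, hj⟩ := exists_isLast hu.supp_nonempty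
        have hjT : j ∈ T.erase i := hus ▸ hj.1
        have hji : j ≠ i := Finset.ne_of_mem_erase hjT
        have hjlt : j < i := lt_of_le_of_ne (hT.1.2 j (Finset.mem_of_mem_erase hjT)) hji
        obtain ⟨w, hw, hws⟩ := hL.exists_circuit (hcard j (Finset.mem_of_mem_erase hjT))
        have hui : u i = 0 := eq_zero_of_notMem_supp (by simp [hus])
        have huj : u j ≠ 0 := mem_supp.1 hj.1
        have hwi : w i ≠ 0 := by
          rw [← mem_supp, hws, Finset.mem_erase]; exact ⟨hji.symm, hT.1.1⟩
        have hhu : h ⬝ᵥ u ≠ 0 := by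
          intro h0
          have := (hlt j hjlt).1 u hu hj
          simp [h0] at this
        set g : Fin n → ℝ := fun l => G l (h l) with hg
        set q := (g ⬝ᵥ u) / (h ⬝ᵥ u) with hq
        have hquot : q * (h ⬝ᵥ u) = g ⬝ᵥ u := div_mul_cancel₀ _ hhu
        filter_upwards [hG i (-(σ i * q))
          ((g ⬝ᵥ w - g i * w i - (h ⬝ᵥ w - h i * w i) * q) / w i)] with y hy _ x hx hxT
        have hxi : x i ≠ 0 := by rw [← mem_supp, hxT]; exact hT.1.1
        rw [hGup]
        have hsub : supp (x - (x i / w i) • w) ⊆ supp u := by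
          intro l hl
          rw [hus, Finset.mem_erase]
          rw [mem_supp] at hl
          constructor
          · rintro rfl; exact hl (by simp [hwi])
          · by_contra hlT
            have h1 : x l = 0 := eq_zero_of_notMem_supp (by rwa [hxT])
            have h2 : w l = 0 := eq_zero_of_notMem_supp (by simp [hws, hlT])
            exact hl (by simp [h1, h2])
        have heq := hL.eq_smul hu (L.sub_mem hx.mem.1 (L.smul_mem (x i / w i) hw.mem)) hsub huj
        set c := (x - (x i / w i) • w) j / u j
        have hxeq : x = (x i / w i) • w + c • u := by rw [← heq]; abel
        have hval : ∀ f : Fin n → ℝ, f ⬝ᵥ x = x i / w i * (f ⬝ᵥ w) + c * (f ⬝ᵥ u) := by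
          intro f
          conv_lhs => rw [hxeq]
          simp only [dotProduct_add, dotProduct_smul, smul_eq_mul]
        have h0 := hx.mem.2
        rw [hval, dotProduct_update, dotProduct_update, hui, mul_zero, add_zero] at h0
        rw [hval, dotProduct_update, dotProduct_update, hui, mul_zero, add_zero]
        have hcu : c * (g ⬝ᵥ u) = -(x i / w i * (h ⬝ᵥ w + (σ i * y - h i) * w i)) * q := by
          rw [← hquot]
          linear_combination q * h0
        rw [hcu]
        have : x i * (x i / w i * (g ⬝ᵥ w + (G i (σ i * y) - g i) * w i) +
            -(x i / w i * (h ⬝ᵥ w + (σ i * y - h i) * w i)) * q)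
            = x i ^ 2 * (G i (σ i * y) + -(σ i * q) * y
              + (g ⬝ᵥ w - g i * w i - (h ⬝ᵥ w - h i * w i) * q) / w i) := by
          field_simp; ring
        rw [this]
        have : 0 < x i ^ 2 := by positivity
        exact mul_pos this hy
      · exact Eventually.of_forall fun y hl x hx hxT =>
          absurd ⟨hl, hxT ▸ hx.card_supp⟩ hT
    obtain ⟨y, h1, h2⟩ := (hfst.and hsnd).exists
    exact ⟨σ i * y, fun x hx hi => h1 _ hi x hx rfl, fun x hx hi => h2 _ hi x hx rfl⟩

end Lifting

section Body

/-! ### Smooth strictly convex bodies seen from a boundary point -/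

variable {N : ℕ} {K : Set (EuclideanSpace ℝ (Fin N))} {p v : EuclideanSpace ℝ (Fin N)}

open Filter Topology

lemma notMem_interior_of_inner_eq {x : EuclideanSpace ℝ (Fin N)} {c : ℝ} (hv : v ≠ 0)
    (hmax : ∀ y ∈ K, inner ℝ y v ≤ c) (hx : inner ℝ x v = c) : x ∉ interior K := by
  intro hint
  have hlim : Tendsto (fun t : ℝ => x + t • v) (𝓝[>] 0) (𝓝 x) := by
    have : ContinuousAt (fun t : ℝ => x + t • v) 0 := by fun_prop
    simpa using this.tendsto.mono_left nhdsWithin_le_nhds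
  obtain ⟨t, ht, ht0⟩ := ((hlim.eventually (mem_interior_iff_mem_nhds.1 hint)).and
    self_mem_nhdsWithin).exists
  have h1 := hmax _ ht
  rw [inner_add_left, real_inner_smul_left, hx] at h1
  have h2 : 0 < inner ℝ v v := real_inner_self_pos.2 hv
  have : 0 < t * inner ℝ v v := mul_pos ht0 h2
  linarith

/-- Smoothness: every ray from a boundary point into the open supporting half-space meets the
interior of the body. -/
lemma IsSmoothStrictlyConvexBody.exists_ray_mem_interior (hK : IsSmoothStrictlyConvexBody K)
    (hp : p ∈ frontier K) (hv : v ≠ 0) (hmax : ∀ x ∈ K, inner ℝ x v ≤ inner ℝ p v)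
    {u : EuclideanSpace ℝ (Fin N)} (hu : inner ℝ u v < 0) :
    ∃ t : ℝ, 0 < t ∧ p + t • u ∈ interior K := by
  by_contra! hno
  -- Otherwise a hyperplane separates the ray from the interior, and it is a supporting one.
  have hray : Convex ℝ ((fun t : ℝ => p + t • u) '' Set.Ioi 0) := by
    rintro _ ⟨s, hs, rfl⟩ _ ⟨t, ht, rfl⟩ a b ha hb hab
    refine ⟨a * s + b * t, ?_, ?_⟩
    · rcases ha.eq_or_lt with rfl | ha'
      · rw [zero_add] at hab; subst hab; simpa using ht
      · exact add_pos_of_pos_of_nonneg (mul_pos ha' hs) (mul_nonneg hb (le_of_lt ht))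
    · have : p = a • p + b • p := by rw [← add_smul, hab, one_smul]
      simp only [smul_add, add_smul, mul_smul]
      conv_lhs => rw [this]
      abel
  have hdisj : Disjoint (interior K) ((fun t : ℝ => p + t • u) '' Set.Ioi 0) := by
    rw [Set.disjoint_right]
    rintro _ ⟨t, ht, rfl⟩
    exact hno t ht
  obtain ⟨f, c, hfK, hfray⟩ :=
    geometric_hahn_banach_open hK.convex.interior isOpen_interior hray hdisj
  let v' := (InnerProductSpace.toDual ℝ (EuclideanSpace ℝ (Fin N))).symm f
  have hf : ∀ x, f x = inner ℝ x v' := fun x => by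
    rw [real_inner_comm, InnerProductSpace.toDual_symm_apply]
  have hray' : ∀ t : ℝ, 0 < t → c ≤ inner ℝ p v' + t * inner ℝ u v' := fun t ht => by
    have := hfray _ ⟨t, ht, rfl⟩
    rwa [hf, inner_add_left, real_inner_smul_left] at this
  have hKc : ∀ x ∈ K, inner ℝ x v' ≤ c := by
    intro x hx
    have hcl : x ∈ closure (interior K) := by
      rw [hK.convex.closure_interior_eq_closure_of_nonempty_interior hK.interior_nonempty]
      exact subset_closure hx
    have hclosed : IsClosed {x | inner ℝ x v' ≤ c} :=
      isClosed_le (by fun_prop) continuous_const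
    exact closure_minimal (fun y hy => ((hf y).symm.trans_lt (hfK y hy)).le) hclosed hcl
  have hpK : p ∈ K := hK.isCompact.isClosed.frontier_subset hp
  have hpc : c ≤ inner ℝ p v' := by
    have hlim : Tendsto (fun t : ℝ => inner ℝ p v' + t * inner ℝ u v') (𝓝[>] 0)
        (𝓝 (inner ℝ p v')) := by
      have : ContinuousAt (fun t : ℝ => inner ℝ p v' + t * inner ℝ u v') 0 := by fun_prop
      simpa using this.tendsto.mono_left nhdsWithin_le_nhds
    refine ge_of_tendsto hlim ?_
    filter_upwards [self_mem_nhdsWithin] with t ht using hray' t ht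
  have hpc' : inner ℝ p v' = c := le_antisymm (hKc p hpK) hpc
  have huv' : 0 ≤ inner ℝ u v' := by
    have := hray' 1 one_pos
    linarith
  obtain ⟨z, hz⟩ := hK.interior_nonempty
  have hzv' : inner ℝ (z - p) v' < 0 := by
    have := hfK z hz
    rw [hf] at this
    rw [inner_sub_left]; linarith
  have hv' : v' ≠ 0 := by
    rintro h0
    simp [h0] at hzv'
  have hzv : inner ℝ (z - p) v < 0 := by
    rw [inner_sub_left, sub_neg]
    exact lt_of_le_of_ne (hmax z (interior_subset hz))
      fun h => notMem_interior_of_inner_eq hv hmax h hz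
  have hH := (hK.smooth p hp).unique
    (y₁ := hyperplane v (inner ℝ p v)) (y₂ := hyperplane v' (inner ℝ p v'))
    ⟨v, hv, rfl, hmax⟩ ⟨v', hv', rfl, fun x hx => (hKc x hx).trans_eq hpc'.symm⟩
  -- The combination of `z - p` and `u` that is parallel to the supporting hyperplane.
  set y := inner ℝ u v • (z - p) - inner ℝ (z - p) v • u with hy
  have hyv : p + y ∈ hyperplane v (inner ℝ p v) := by
    change inner ℝ (p + y) v = inner ℝ p v
    rw [hy, inner_add_left, inner_sub_left, real_inner_smul_left, real_inner_smul_left]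
    ring
  rw [hH] at hyv
  change inner ℝ (p + y) v' = inner ℝ p v' at hyv
  rw [hy, inner_add_left, inner_sub_left, real_inner_smul_left, real_inner_smul_left] at hyv
  nlinarith [mul_pos_of_neg_of_neg hu hzv', mul_nonneg (neg_nonneg.2 hzv.le) huv']

lemma IsSmoothStrictlyConvexBody.exists_ray_mem_frontier (hK : IsSmoothStrictlyConvexBody K)
    (hp : p ∈ frontier K) (hv : v ≠ 0) (hmax : ∀ x ∈ K, inner ℝ x v ≤ inner ℝ p v)
    {u : EuclideanSpace ℝ (Fin N)} (hu : inner ℝ u v < 0) :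
    ∃ t : ℝ, 0 < t ∧ p + t • u ∈ frontier K := by
  obtain ⟨t₀, ht₀, hint⟩ := hK.exists_ray_mem_interior hp hv hmax hu
  have hu0 : u ≠ 0 := by rintro rfl; simp at hu
  -- The last point of the ray in `K`.
  have hcpt : IsCompact ((fun t : ℝ => p + t • u) ⁻¹' K) := by
    apply Topology.IsClosedEmbedding.isCompact_preimage _ hK.isCompact
    exact (Homeomorph.addLeft p).isClosedEmbedding.comp
      (isClosedEmbedding_smul_left hu0)
  have ht₀K : p + t₀ • u ∈ K := interior_subset hint
  obtain ⟨t, ht, htmax⟩ := hcpt.exists_isGreatest ⟨t₀, ht₀K⟩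
  refine ⟨t, ht₀.trans_le (htmax ht₀K), ?_⟩
  rw [hK.isCompact.isClosed.frontier_eq]
  refine ⟨ht, fun hti => ?_⟩
  have hlim : Tendsto (fun s : ℝ => p + s • u) (𝓝[>] t) (𝓝 (p + t • u)) := by
    have : ContinuousAt (fun s : ℝ => p + s • u) t := by fun_prop
    exact this.tendsto.mono_left nhdsWithin_le_nhds
  obtain ⟨s, hs, hts⟩ := ((hlim.eventually (mem_interior_iff_mem_nhds.1 hti)).and
    self_mem_nhdsWithin).exists
  exact absurd (htmax hs) (not_le.2 hts)

/-- Strict convexity: the points of `K` on the rays of direction `u + y • w`, with `w` parallel to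
the supporting hyperplane at `p`, approach `p` as `y` grows. -/
lemma IsSmoothStrictlyConvexBody.eventually_mul_le (hK : IsSmoothStrictlyConvexBody K)
    (hp : p ∈ frontier K) (hv : v ≠ 0) (hmax : ∀ x ∈ K, inner ℝ x v ≤ inner ℝ p v)
    {u w : EuclideanSpace ℝ (Fin N)} (hw : w ≠ 0) (hwv : inner ℝ w v = 0) {t : ℝ → ℝ}
    (htK : ∀ y, p + t y • (u + y • w) ∈ K) {δ : ℝ} (hδ : 0 < δ) :
    ∀ᶠ y in atTop, y * t y ≤ δ := by
  have hclosed := hK.isCompact.isClosed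
  have hpK : p ∈ K := hclosed.frontier_subset hp
  by_contra hno
  have hfreq : ∃ᶠ y in atTop, p + ((δ / y) • u + δ • w) ∈ K := by
    rw [Filter.not_eventually] at hno
    refine (hno.and_eventually (eventually_gt_atTop 0)).mono ?_
    rintro y ⟨hy, hy0⟩
    push Not at hy
    have hyt : 0 < y * t y := hδ.trans hy
    have hty : t y ≠ 0 := fun h => by simp [h] at hyt
    have := hK.convex.add_smul_sub_mem hpK (htK y) (t := δ / (y * t y))
      ⟨by positivity, by rw [div_le_one hyt]; exact hy.le⟩
    convert this using 2
    rw [add_sub_cancel_left, smul_add, smul_add, smul_smul, smul_smul, smul_smul]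
    congr 2
    · field_simp
    · field_simp
  have hlim : Tendsto (fun y : ℝ => p + ((δ / y) • u + δ • w)) atTop (𝓝 (p + δ • w)) := by
    have h1 : Tendsto (fun y : ℝ => δ / y) atTop (𝓝 0) := tendsto_const_nhds.div_atTop tendsto_id
    have h2 := (h1.smul_const u).add_const (δ • w)
    simpa using h2.const_add p
  have hq : p + δ • w ∈ K := hclosed.mem_of_frequently_of_tendsto hfreq hlim
  refine hK.no_segment p (p + δ • w) (by simpa using ⟨hδ.ne', hw⟩) fun x hx => ?_
  rw [hclosed.frontier_eq]
  refine ⟨hK.convex.segment_subset hpK hq hx, notMem_interior_of_inner_eq hv hmax ?_⟩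
  rw [segment_eq_image'] at hx
  obtain ⟨s, -, rfl⟩ := hx
  simp [inner_add_left, real_inner_smul_left, hwv]

lemma IsSmoothStrictlyConvexBody.exists_supporting [Nontrivial (EuclideanSpace ℝ (Fin N))]
    (hK : IsSmoothStrictlyConvexBody K) :
    ∃ p ∈ frontier K, ∃ v : EuclideanSpace ℝ (Fin N), v ≠ 0 ∧
      ∀ x ∈ K, inner ℝ x v ≤ inner ℝ p v := by
  obtain ⟨p, hp⟩ : (frontier K).Nonempty := nonempty_frontier_iff.2
    ⟨hK.interior_nonempty.mono interior_subset, hK.isCompact.ne_univ⟩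
  obtain ⟨H, ⟨v, hv, -, hmax⟩, -⟩ := hK.smooth p hp
  exact ⟨p, hp, v, hv, hmax⟩

end Body

section Inscribed

variable {n d : ℕ}

open Filter

/-! ### Inscribed realizations -/

/-- The lift of `a` to height `z`. -/
noncomputable def liftPoint (a : EuclideanSpace ℝ (Fin d)) (z : ℝ) :
    EuclideanSpace ℝ (Fin (d + 1)) :=
  WithLp.toLp 2 (Fin.snoc (fun j => a j) z)

lemma liftPoint_eq (a : EuclideanSpace ℝ (Fin d)) (z : ℝ) :
    liftPoint a z = liftPoint a 0 + z • EuclideanSpace.single (Fin.last d) 1 := by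
  ext j
  induction j using Fin.lastCases with
  | last => simp [liftPoint]
  | cast j => simp [liftPoint]

/-- A projective transformation makes the boundary of a smooth strictly convex body minus a point
the graph of a superlinear function over `ℝ^(d + 1)`. Points of this graph with fast growing
coordinates are a positive lexicographic lifting of a lexicographic lifting with prescribed
signs. -/
lemma exists_inscribed (A : Fin n → EuclideanSpace ℝ (Fin d)) {r : ℕ}
    (hA : IsUniform (dependences A) r) (σ : Fin n → ℝ) (hσ : ∀ i, σ i = 1 ∨ σ i = -1)
    {K : Set (EuclideanSpace ℝ (Fin (d + 2)))} (hK : IsSmoothStrictlyConvexBody K) :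
    ∃ (Q : Fin n → EuclideanSpace ℝ (Fin (d + 2))) (h g s : Fin n → ℝ),
      (∀ i, Q i ∈ frontier K) ∧ IsLexHeight (dependences A) r σ h ∧
      IsLexHeight (slice (dependences A) h) (r + 1) 1 g ∧ (∀ i, 0 < s i) ∧
      ∀ x, x ∈ dependences Q ↔ s * x ∈ slice (slice (dependences A) h) g := by
  obtain ⟨p, hp, v, hv, hmax⟩ := hK.exists_supporting
  have : Fact (Module.finrank ℝ (EuclideanSpace ℝ (Fin (d + 2))) = (d + 1) + 1) :=
    ⟨by simp⟩
  let e : EuclideanSpace ℝ (Fin (d + 1)) ≃ₗ[ℝ] (ℝ ∙ v)ᗮ := LinearEquiv.ofFinrankEq _ _ (by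
    rw [Submodule.finrank_orthogonal_span_singleton (n := d + 1) hv]; simp)
  have hev : ∀ b, inner ℝ (e b : EuclideanSpace ℝ (Fin (d + 2))) v = 0 := fun b => by
    rw [real_inner_comm]; exact Submodule.mem_orthogonal_singleton_iff_inner_right.1 (e b).2
  have hvv : 0 < inner ℝ v v := real_inner_self_pos.2 hv
  -- The directions from `p` that point into the body, parametrized by their projection to `ℝ^(d+1)`.
  let u : EuclideanSpace ℝ (Fin (d + 1)) → EuclideanSpace ℝ (Fin (d + 2)) := fun b => e b - v
  have huv : ∀ b, inner ℝ (u b) v < 0 := fun b => by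
    rw [inner_sub_left, hev]; linarith
  choose t ht htK using fun b => hK.exists_ray_mem_frontier hp hv hmax (huv b)
  have hfK := hK.isCompact.isClosed.frontier_subset
  set w : EuclideanSpace ℝ (Fin (d + 2)) :=
    ((e (EuclideanSpace.single (Fin.last d) 1) : (ℝ ∙ v)ᗮ) : EuclideanSpace ℝ (Fin (d + 2)))
    with hwdef
  have hw : w ≠ 0 := by
    rw [hwdef, Ne, Submodule.coe_eq_zero, LinearEquiv.map_eq_zero_iff]
    intro h0
    simpa using congrFun (congrArg WithLp.ofLp h0) (Fin.last d)
  have hu : ∀ a z, u (liftPoint a z) = u (liftPoint a 0) + z • w := fun a z => by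
    simp only [u]
    rw [liftPoint_eq a z, map_add, map_smul]
    push_cast
    abel
  obtain ⟨h, hh, hg⟩ := exists_lexHeights hA σ hσ (fun i z => (t (liftPoint (A i) z))⁻¹) (by
    intro i a b
    have hM : 0 < |a| + |b| + 1 := by positivity
    have := hK.eventually_mul_le hp hv hmax (u := u (liftPoint (A i) 0)) (w := σ i • w)
      (t := fun y => t (liftPoint (A i) (σ i * y)))
      (smul_ne_zero (by rcases hσ i with h | h <;> simp [h]) hw)
      (by rw [real_inner_smul_left, hev, mul_zero])
      (fun y => hfK (by
        have := htK (liftPoint (A i) (σ i * y))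
        rwa [hu, mul_comm, ← smul_smul, mul_comm] at this)) (inv_pos.2 hM)
    filter_upwards [this, eventually_ge_atTop 1] with y hy hy1
    have hty := ht (liftPoint (A i) (σ i * y))
    have h1 : (|a| + |b| + 1) * y ≤ (t (liftPoint (A i) (σ i * y)))⁻¹ := by
      rw [le_inv_comm₀ (by positivity) hty, mul_inv, ← div_eq_mul_inv, le_div_iff₀ (by linarith)]
      linarith
    have h2 : -(|a| * y) ≤ a * y := by
      nlinarith [neg_abs_le a]
    have h3 : -(|b| * y) ≤ b := by
      nlinarith [neg_abs_le b, abs_nonneg b]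
    nlinarith)
  let B : Fin n → EuclideanSpace ℝ (Fin (d + 1)) := fun i => liftPoint (A i) (h i)
  refine ⟨fun i => p + t (B i) • u (B i), h, _, fun i => t (B i), fun i => htK _, hh, hg,
    fun i => ht _, fun x => ?_⟩
  have hB : slice (dependences A) h = dependences B := by
    rw [dependences_eq_slice (A := A) (fun i j => by simp [B, liftPoint])]
    congr 1
    ext i
    simp [height, B, liftPoint]
  rw [mem_slice, hB, mem_dependences, mem_dependences]
  set y : Fin n → ℝ := fun i => t (B i) * x i with hy
  have hyx : (fun i => t (B i)) * x = y := rfl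
  rw [hyx]
  have hdot : (fun i => (t (liftPoint (A i) (h i)))⁻¹) ⬝ᵥ y = ∑ i, x i := by
    refine Finset.sum_congr rfl fun i _ => ?_
    rw [hy]
    exact inv_mul_cancel_left₀ (ht _).ne' _
  have hQ : ∑ i, x i • (p + t (B i) • u (B i)) =
      (∑ i, x i) • p + ((e (∑ i, y i • B i) : (ℝ ∙ v)ᗮ) - (∑ i, y i) • v) := by
    simp only [hy, u, smul_add, smul_sub, Finset.sum_add_distrib, Finset.sum_sub_distrib,
      Finset.sum_smul, map_sum, map_smul, smul_smul, mul_comm]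
    push_cast
    rfl
  rw [hdot, hQ]
  constructor
  · rintro ⟨h1, h2⟩
    rw [h1, zero_smul, zero_add] at h2
    have h3 := congrArg (fun q => inner ℝ q v) h2
    simp only [inner_sub_left, hev, real_inner_smul_left, inner_zero_left, zero_sub,
      neg_eq_zero] at h3
    have h4 : ∑ i, y i = 0 := (mul_eq_zero.1 h3).resolve_right hvv.ne'
    rw [h4, zero_smul, sub_zero, Submodule.coe_eq_zero, LinearEquiv.map_eq_zero_iff] at h2
    exact ⟨⟨h4, h2⟩, h1⟩
  · rintro ⟨⟨h1, h2⟩, h3⟩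
    rw [h1, h2, h3]
    simp

end Inscribed

end LexLifting

theorem theorem5p4 (d n k : ℕ) (hn : d + 3 ≤ n)
    (A : Fin n → EuclideanSpace ℝ (Fin d))
    (hgen : LexLifting.InGeneralPosition A)
    (hA : LexLifting.IsPolytopeVertices A)
    (hk : LexLifting.IsKNeighborly k A)
    (B : Fin n → EuclideanSpace ℝ (Fin (d + 1)))
    (hB : LexLifting.IsLexLifting A B)
    (C : Fin n → EuclideanSpace ℝ (Fin (d + 2)))
    (hC : LexLifting.IsPositiveLexLifting B C) :
    (LexLifting.IsPolytopeVertices C ∧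
      LexLifting.IsKNeighborly (k + 1) C ∧
      (LexLifting.IsNeighborly A → LexLifting.IsNeighborly C)) ∧
    ∀ K : Set (EuclideanSpace ℝ (Fin (d + 2))),
      LexLifting.IsSmoothStrictlyConvexBody K → LexLifting.IsInscribable K C := by
  open LexLifting in
  have hUA := hgen.isUniform (by omega)
  have hhB := hB.isLexHeight hUA
  have hdB := dependences_eq_slice hB.1
  have hUB := hhB.isUniform_slice hUA
  have hgC := hC.1.isLexHeight (hdB ▸ hUB)
  rw [hC.heightSign_eq, hdB] at hgC
  have hdC := dependences_eq_slice hC.1.1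
  rw [hdB] at hdC
  have hUC : IsUniform (dependences C) (d + 2 + 1) := hdC ▸ hgC.isUniform_slice hUB
  have hneigh : ∀ j, IsKNeighborly j A → IsKNeighborly (j + 1) C := fun j hj =>
    isKNeighborly_of_double_slice hUA hhB hgC hdC hj
  have hvert : ∀ i, {i} ∈ faceLabels C := fun i => by
    simpa using hneigh 0 (isKNeighborly_zero A) {i} (Finset.card_singleton i)
  refine ⟨⟨isPolytopeVertices_of_isUniform hUC hn (by omega) hvert, hneigh k hk, fun h => ?_⟩,
    fun K hK => ?_⟩
  · have := hneigh (d / 2) h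
    rwa [show d / 2 + 1 = (d + 2) / 2 by omega] at this
  · obtain ⟨Q, h, g, s, hQK, hh, hg, hs, hQ⟩ :=
      exists_inscribed A hUA (heightSign B) (heightSign_eq_one_or B) hK
    have hUQ := (hg.isUniform_slice (hh.isUniform_slice hUA)).rescale hs hQ
    have hres := circuitSignsLE_rescale (r := d + 2 + 1) hs hQ
    have hrefl := CircuitSignsLE.refl (dependences A) (d + 1)
    have hCQ : CircuitSignsLE (dependences C) (dependences Q) (d + 2 + 1) := by
      rw [hdC]
      exact ((hrefl.slice hUA hUA hhB hh).slice hUB (hh.isUniform_slice hUA) hgC hg).trans hres.1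
    have hQC : CircuitSignsLE (dependences Q) (dependences C) (d + 2 + 1) := by
      rw [hdC]
      exact hres.2.trans
        ((hrefl.slice hUA hUA hh hhB).slice (hh.isUniform_slice hUA) hUB hg hgC)
    have heq : faceLabels C = faceLabels Q :=
      Set.Subset.antisymm (faceLabels_subset_of_circuitSignsLE hUQ hUC hQC)
        (faceLabels_subset_of_circuitSignsLE hUC hUQ hCQ)
    exact ⟨Q, isPolytopeVertices_of_isUniform hUQ hn (by omega) fun i => heq ▸ hvert i, hQK, heq⟩
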